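/- **Theorem (semantic correctness of forward-mode AD at first-order types).** *Language.* Types are $\tau ::= \mathbf{real} \mid \tau_1 * \cdots * \tau_n \mid \tau\to\tau' \mid \{\ell_1\,\tau_1 \mid\cdots\mid \ell_n\,\tau_n\} \mid \mathbf{list}(\tau)$ with $n \ge 0$. Typed terms $\Gamma\vdash t:\tau$ are built from variables, real constants $\underline c$, $t+s$, $t*s$, $\varsigma(t)$, further operations $\mathsf{op}(t_1,\dots,t_n)$ from a given family of operations $\mathbf{real}^n\to\mathbf{real}$, tuples and pattern matching on tuples, $\lambda$-abstraction and application, injections into and case distinction on variants, $[\,]$, $t::s$ and $\mathbf{fold}\,(x_1,x_2).t\ \mathbf{over}\ s\ \mathbf{from}\ r$. Each $\mathsf{op}$ is interpreted by a smooth function $\mathbb R^n\to\mathbb R$ and comes with chosen terms $x_1,\dots,x_n:\mathbf{real}\vdash\partial_i\mathsf{op}:\mathbf{real}$ $(1\le i\le n)$ whose interpretation is the $i$-th partial derivative of the interpretation of $\mathsf{op}$. *Semantics.* Types and contexts are interpreted as diffeological spaces: $[\![\mathbf{real}]\!]=\mathbb R$, products (and contexts) by product spaces, $\tau\to\tau'$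 by the space of smooth maps with the functional diffeology, variants by disjoint unions, $[\![\mathbf{list}(\tau)]\!]=\biguplus_{k\ge 0}[\![\tau]\!]^k$. Terms $\Gamma\vdash t:\tau$ are interpreted in the usual way as smooth maps $[\![t]\!]:[\![\Gamma]\!]\to[\![\tau]\!]$, with $\varsigma(x)=1/(1+e^{-x})$ and $\mathbf{fold}$ as the right fold. *Macro.* $\mathcal D(\mathbf{real})=\mathbf{real}*\mathbf{real}$, and $\mathcal D$ commutes with the other type constructors and is applied to the types of all variables of a context. On terms, $\mathcal D(x)=x$, $\mathcal D(\underline c)=\langle\underline c,\underline 0\rangle$; with $\mathcal D(t)$ matched as $\langle x,x'\rangle$, $\mathcal D(s)$ as $\langle y,y'\rangle$ and $\mathcal D(t_i)$ as $\langle x_i,x_i'\rangle$, $$\mathcal D(t+s)=\langle x+y,\,x'+y'\rangle,\quad \mathcal D(t*s)=\langle x*y,\,x*y'+x'*y\rangle,\quad \mathcal D(\varsigma(t))=\mathbf{let}\ z=\varsigma(x)\ \mathbf{in}\ \langle z,\,x'*z*(1-z)\rangle,$$ $$\mathcal D(\mathsf{op}(t_1,\dots,t_n))=\Big\langle \mathsf{op}(x_1,\dots,x_n),\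 \sum_{i=1}^n x_i'*\partial_i\mathsf{op}(x_1,\dots,x_n)\Big\rangle;$$ $\mathcal D$ commutes with all other term constructors. Thus $\mathcal D\Gamma\vdash\mathcal D t:\mathcal D\tau$ whenever $\Gamma\vdash t:\tau$. *Manifolds.* A manifold is a diffeological space that is Hausdorff and second countable in its D-topology and in which every point lies in an open subset diffeomorphic to some $\mathbb R^k$ (with $k$ depending on the point). The tangent bundle $TM$ of a manifold $M$ consists of the pairs $(x,[\gamma])$ with $\gamma:\mathbb R\to M$ smooth and $\gamma(0)=x$, where $\gamma\sim\delta$ iff $\gamma(0)=\delta(0)$ and $(f\circ\gamma)'(0)=(f\circ\delta)'(0)$ for all smooth $f:M\to\mathbb R$; it is a manifold with charts $(x,v)\mapsto[t\mapsto\psi(x+tv)]$ for the charts $\psi:\mathbb R^k\to M$. For smooth $f:M\to N$, $Tf(x,[\gamma])=(f(x),[f\circ\gamma])$. *Canonical maps.* For a first-order type $\tau$ (one without function types) define $\phi_\tau:[\![\mathcal D\tau]\!]\to T[\![\tau]\!]$ by induction: $\phi_{\mathbf{real}}(x,x')=(x,[t\mapsto x+x't])$; at products by the canonical map $TM_1\times\cdots\times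 TM_n\to T(M_1\times\cdots\times M_n)$, $([\gamma_i])_i\mapsto[t\mapsto(\gamma_i(t))_i]$; at variants and lists by the canonical maps $\biguplus_i TM_i\to T(\biguplus_i M_i)$ induced by the inclusions, combined with the previous one for the powers $[\![\tau]\!]^k$. For a first-order context $\Gamma$ (all of whose variables have first-order types), $\phi_\Gamma:[\![\mathcal D\Gamma]\!]\to T[\![\Gamma]\!]$ is defined as for products. *Claim.* Let $\tau$ be a first-order type, $\Gamma$ a first-order context and $\Gamma\vdash t:\tau$ any term (which may use higher-order subterms). Then $[\![\Gamma]\!]$ and $[\![\tau]\!]$ are manifolds, $\phi_\Gamma:[\![\mathcal D\Gamma]\!]\to T[\![\Gamma]\!]$ and $\phi_\tau:[\![\mathcal D\tau]\!]\to T[\![\tau]\!]$ are diffeomorphisms, and $$\phi_\tau\circ[\![\mathcal D t]\!] = T[\![t]\!]\circ\phi_\Gamma .$$ -/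

import Mathlib

open scoped ContDiff Topology
open Diffeology

noncomputable section

namespace AD

universe u

/-! ### Diffeological spaces

Mathlib's diffeologies are given by plots on the whole spaces `ℝⁿ`. As `ℝⁿ` is connected, a plot of
a disjoint union factors through one summand. -/

/-- The model space `ℝⁿ`. -/
abbrev E (n : ℕ) : Type := EuclideanSpace ℝ (Fin n)

/-- Product diffeology of two spaces. -/
instance instProd {X Y : Type*} [DiffeologicalSpace X] [DiffeologicalSpace Y] :
    DiffeologicalSpace (X × Y) where
  plots _ := {p | IsPlot (fun u => (p u).1) ∧ IsPlot (fun u => (p u).2)}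
  constant_plots _ := ⟨isPlot_const, isPlot_const⟩
  plot_reparam hp hf := ⟨isPlot_reparam hp.1 hf, isPlot_reparam hp.2 hf⟩
  locality hp := by
    constructor
    · refine DiffeologicalSpace.locality fun x => ?_
      obtain ⟨v, hv, hx, h⟩ := hp x
      exact ⟨v, hv, hx, fun hf hs => (h hf hs).1⟩
    · refine DiffeologicalSpace.locality fun x => ?_
      obtain ⟨v, hv, hx, h⟩ := hp x
      exact ⟨v, hv, hx, fun hf hs => (h hf hs).2⟩

/-- Product diffeology of a family. -/
instance instPi {ι : Type*} {X : ι → Type*} [∀ i, DiffeologicalSpace (X i)] :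
    DiffeologicalSpace (∀ i, X i) where
  plots _ := {p | ∀ i, IsPlot (fun u => p u i)}
  constant_plots _ := fun _ => isPlot_const
  plot_reparam hp hf := fun i => isPlot_reparam (hp i) hf
  locality hp := fun i => by
    refine DiffeologicalSpace.locality fun x => ?_
    obtain ⟨v, hv, hx, h⟩ := hp x
    exact ⟨v, hv, hx, fun hf hs => h hf hs i⟩

/-- The smooth maps `X → Y`. -/
def DMap (X Y : Type*) [DiffeologicalSpace X] [DiffeologicalSpace Y] : Type _ :=
  {f : X → Y // DSmooth f}

instance instDMapCoe {X Y : Type*} [DiffeologicalSpace X] [DiffeologicalSpace Y] :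
    CoeFun (DMap X Y) (fun _ => X → Y) := ⟨fun f => f.1⟩

/-- Composition of smooth maps. -/
def DMap.comp {X Y Z : Type*} [DiffeologicalSpace X] [DiffeologicalSpace Y] [DiffeologicalSpace Z]
    (g : DMap Y Z) (f : DMap X Y) : DMap X Z := ⟨fun x => g (f x), g.2.comp f.2⟩

/-- Functional diffeology: `p` is a plot iff `(u, x) ↦ p u x` is smooth. -/
instance instDMap {X Y : Type*} [DiffeologicalSpace X] [DiffeologicalSpace Y] :
    DiffeologicalSpace (DMap X Y) where
  plots n := {p | DSmooth (fun z : E n × X => p z.1 z.2)}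
  constant_plots f := fun _ _ hp => f.2 _ _ hp.2
  plot_reparam {n m p f} hp hf := fun k q hq =>
    hp k (fun u => (f (q u).1, (q u).2)) ⟨(hf.comp hq.1.contDiff).isPlot, hq.2⟩
  locality {n p} hp := fun k q hq => by
    refine DiffeologicalSpace.locality fun x => ?_
    obtain ⟨v, hv, hx, h⟩ := hp (q x).1
    refine ⟨(fun u => (q u).1) ⁻¹' v, hv.preimage hq.1.contDiff.continuous, hx, ?_⟩
    intro m f hf hs
    exact h (f := fun w => (q (f w)).1) hf (hq.1.contDiff.comp hs) m
      (fun w => (w, (q (f w)).2)) ⟨isPlot_id, isPlot_reparam hq.2 hs⟩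

/-- Disjoint union: the plots are the plots of the summands. -/
instance instSigma {ι : Type*} {X : ι → Type*} [∀ i, DiffeologicalSpace (X i)] :
    DiffeologicalSpace (Σ i, X i) where
  plots n := {p | ∃ (i : ι) (q : E n → X i), IsPlot q ∧ p = fun u => ⟨i, q u⟩}
  constant_plots x := ⟨x.1, fun _ => x.2, isPlot_const, rfl⟩
  plot_reparam {n m p f} hp hf := by
    obtain ⟨i, q, hq, rfl⟩ := hp
    exact ⟨i, q ∘ f, isPlot_reparam hq hf, rfl⟩
  locality {n p} hp := by
    have hloc : IsLocallyConstant (fun u => (p u).1) := by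
      rw [IsLocallyConstant.iff_exists_open]
      intro x
      obtain ⟨v, hv, hx, h⟩ := hp x
      obtain ⟨ε, hε, hb⟩ := Metric.isOpen_iff.mp hv x hx
      have ht := OpenPartialHomeomorph.univBall_target x hε
      have hs := OpenPartialHomeomorph.univBall_source (E := E n) x ε
      obtain ⟨i, q, -, he⟩ := h (f := OpenPartialHomeomorph.univBall x ε)
        (fun y => hb (ht ▸ (OpenPartialHomeomorph.univBall x ε).map_source (hs ▸ Set.mem_univ y)))
        OpenPartialHomeomorph.contDiff_univBall
      have key : ∀ y ∈ Metric.ball x ε, (p y).1 = i := by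
        intro y hy
        have h1 := (OpenPartialHomeomorph.univBall x ε).right_inv (ht ▸ hy)
        have h2 := congrFun he ((OpenPartialHomeomorph.univBall x ε).symm y)
        simp only [Function.comp_apply, h1] at h2
        rw [h2]
      exact ⟨_, Metric.isOpen_ball, Metric.mem_ball_self hε, fun y hy =>
        (key y hy).trans (key x (Metric.mem_ball_self hε)).symm⟩
    have hc : ∀ u, ∃ a : X (p 0).1, p u = ⟨(p 0).1, a⟩ := by
      intro u
      have h0 : (p u).1 = (p 0).1 := hloc.apply_eq_of_preconnectedSpace u 0
      exact ⟨h0 ▸ (p u).2, Sigma.ext h0 (by simp)⟩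
    choose q hq using hc
    refine ⟨_, q, DiffeologicalSpace.locality fun x => ?_, funext hq⟩
    obtain ⟨v, hv, hx, h⟩ := hp x
    refine ⟨v, hv, hx, fun {m f} hf hs => ?_⟩
    obtain ⟨j, q', hq', he⟩ := h hf hs
    have hj : (p 0).1 = j := by
      have := congrFun he 0
      rw [Function.comp_apply, hq (f 0)] at this
      exact congrArg Sigma.fst this
    subst hj
    have : q ∘ f = q' := by
      funext y
      have := congrFun he y
      rw [Function.comp_apply, hq (f y)] at this
      exact eq_of_heq (Sigma.mk.inj this).2
    rw [this]
    exact hq'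

/-- Lists: the diffeology of the disjoint union of the powers `Xᵏ`, for `k = 0, 1, 2, …`. -/
instance instList {X : Type*} [DiffeologicalSpace X] : DiffeologicalSpace (List X) where
  plots n := {p | IsPlot (fun u : E n => List.equivSigmaTuple (p u))}
  constant_plots x := by
    change IsPlot (fun _ => List.equivSigmaTuple x)
    exact isPlot_const
  plot_reparam {n m p f} hp hf := by
    change IsPlot (fun u => List.equivSigmaTuple (p u)) at hp
    exact isPlot_reparam hp hf
  locality {n p} hp := by
    change IsPlot (fun u => List.equivSigmaTuple (p u))
    exact DiffeologicalSpace.locality hp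

instance instUnit : DiffeologicalSpace Unit where
  plots _ := Set.univ
  constant_plots _ := trivial
  plot_reparam _ _ := trivial
  locality _ := trivial

theorem isPlot_list_iff {X : Type*} [DiffeologicalSpace X] {n : ℕ} {p : E n → List X} :
    IsPlot p ↔ ∃ (k : ℕ) (q : E n → Fin k → X),
      (∀ i, IsPlot (fun u => q u i)) ∧ p = fun u => List.ofFn (q u) := by
  change IsPlot (fun u => List.equivSigmaTuple (p u)) ↔ _
  constructor
  · rintro ⟨k, q, hq, he⟩
    refine ⟨k, q, hq, funext fun u => ?_⟩
    have := congrArg List.equivSigmaTuple.symm (congrFun he u)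
    simpa using this
  · rintro ⟨k, q, hq, rfl⟩
    exact ⟨k, q, hq, funext fun u => List.equivSigmaTuple.apply_symm_apply ⟨k, q u⟩⟩

/-- The inclusion of a summand. -/
def injMap {ι : Type*} {X : ι → Type*} [∀ i, DiffeologicalSpace (X i)] (i : ι) :
    DMap (X i) (Σ i, X i) := ⟨fun a => ⟨i, a⟩, fun _ p hp => ⟨i, p, hp, rfl⟩⟩

/-- The inclusion of the lists of length `k`. -/
def listMap {X : Type*} [DiffeologicalSpace X] (k : ℕ) : DMap (Fin k → X) (List X) :=
  ⟨List.ofFn, fun _ p hp => isPlot_list_iff.2 ⟨k, p, hp, rfl⟩⟩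

/-- `f` is an isomorphism of diffeological spaces. -/
def IsDiffeo {X Y : Type*} [DiffeologicalSpace X] [DiffeologicalSpace Y] (f : X → Y) : Prop :=
  DSmooth f ∧ ∃ g : Y → X, DSmooth g ∧ Function.LeftInverse g f ∧ Function.RightInverse g f

/-! ### Manifolds and tangent bundles -/

/-- `ψ : ℝᵏ → X` is the inverse of a chart: a diffeomorphism of `ℝᵏ` onto an open subset. -/
def IsChart {X : Type*} [DiffeologicalSpace X] {k : ℕ} (ψ : E k → X) : Prop :=
  IsPlot ψ ∧ Function.Injective ψ ∧ IsOpen[dTopology] (Set.range ψ) ∧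
    ∀ (n : ℕ) (q : E n → E k), IsPlot (ψ ∘ q) → ContDiff ℝ ∞ q

/-- Smooth manifolds, as a full subcategory of the diffeological spaces: Hausdorff, second countable
and covered by charts, whose dimensions may vary. -/
def IsSmoothManifold (X : Type*) [DiffeologicalSpace X] : Prop :=
  @T2Space X dTopology ∧ @SecondCountableTopology X dTopology ∧
    ∀ x : X, ∃ (k : ℕ) (ψ : E k → X), IsChart ψ ∧ x ∈ Set.range ψ

/-- Two smooth curves are tangent at `0`: they have the same base point `γ 0`, and
`(f ∘ γ)' (0) = (f ∘ δ)' (0)` for all smooth `f : X → ℝ`. -/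
def tangentSetoid (X : Type*) [DiffeologicalSpace X] : Setoid (DMap ℝ X) where
  r γ δ := γ 0 = δ 0 ∧
    ∀ f : DMap X ℝ, deriv (fun t => f (γ t)) 0 = deriv (fun t => f (δ t)) 0
  iseqv :=
    { refl := fun _ => ⟨rfl, fun _ => rfl⟩
      symm := fun h => ⟨h.1.symm, fun f => (h.2 f).symm⟩
      trans := fun h h' => ⟨h.1.trans h'.1, fun f => (h.2 f).trans (h'.2 f)⟩ }

/-- The tangent bundle, the disjoint union over `x` of the classes of curves with `γ 0 = x`. -/
def Tangent (X : Type*) [DiffeologicalSpace X] : Type _ := Quotient (tangentSetoid X)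

section Tangent

variable {X Y : Type*} [DiffeologicalSpace X] [DiffeologicalSpace Y]

/-- The tangent vector `(γ 0, [γ])`. -/
def Tangent.mk (γ : DMap ℝ X) : Tangent X := Quotient.mk (tangentSetoid X) γ

/-- The derivative of a smooth map, `(x, [γ]) ↦ (f x, [f ∘ γ])`. -/
def Tangent.map (f : DMap X Y) : Tangent X → Tangent Y :=
  Quotient.map' (s₁ := tangentSetoid X) (s₂ := tangentSetoid Y) (fun γ => f.comp γ)
    (fun _ _ h => ⟨congrArg f.1 h.1, fun g => h.2 (g.comp f)⟩)

/-- The straight line `t ↦ ψ (x + t v)` in a chart. -/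
def chartLine {k : ℕ} (ψ : E k → X) (hψ : IsPlot ψ) (x v : E k) : DMap ℝ X :=
  ⟨fun t => ψ (x + t • v), hψ.dSmooth.comp' (ContDiff.dSmooth (by fun_prop))⟩

/-- The structure of a manifold on the tangent bundle: its charts are the maps
`(x, v) ↦ [t ↦ ψ (x + t v)]` for the charts `ψ` of `X`. -/
instance instTangent (X : Type*) [DiffeologicalSpace X] : DiffeologicalSpace (Tangent X) :=
  DiffeologicalSpace.generateFrom
    {p | ∃ (k : ℕ) (ψ : E k → X) (hψ : IsChart ψ) (x v : E p.1 → E k),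
      ContDiff ℝ ∞ x ∧ ContDiff ℝ ∞ v ∧
        p.2 = fun w => Tangent.mk (chartLine ψ hψ.1 (x w) (v w))}

/-- The smooth curve `t ↦ (γ t, δ t)`. -/
def pairCurve (γ : DMap ℝ X) (δ : DMap ℝ Y) : DMap ℝ (X × Y) :=
  ⟨fun t => (γ t, δ t), fun _ p hp => ⟨γ.2 _ p hp, δ.2 _ p hp⟩⟩

theorem deriv_pair (γ : DMap ℝ X) (δ : DMap ℝ Y) (f : DMap (X × Y) ℝ) :
    deriv (fun t => f (γ t, δ t)) 0
      = deriv (fun t => f (γ t, δ 0)) 0 + deriv (fun t => f (γ 0, δ t)) 0 := by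
  have hF : ContDiff ℝ ∞ (fun z : E 2 => f (γ (z 0), δ (z 1))) := by
    refine IsPlot.contDiff (f.2 2 (fun z => (γ (z 0), δ (z 1))) ⟨?_, ?_⟩)
    · exact γ.2 _ _ (ContDiff.isPlot (by fun_prop))
    · exact δ.2 _ _ (ContDiff.isPlot (by fun_prop))
  set F := fun z : E 2 => f (γ (z 0), δ (z 1))
  have hd : HasFDerivAt F (fderiv ℝ F 0) 0 :=
    (hF.differentiable (by simp) 0).hasFDerivAt
  have key : ∀ a : E 2, deriv (fun t : ℝ => F (t • a)) 0 = fderiv ℝ F 0 a := by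
    intro a
    have h1 : HasDerivAt (fun t : ℝ => t • a) a 0 := by
      simpa using (hasDerivAt_id (0 : ℝ)).smul_const a
    have h2 : HasFDerivAt F (fderiv ℝ F 0) ((0 : ℝ) • a) := by simpa using hd
    exact (h2.comp_hasDerivAt (0 : ℝ) h1).deriv
  have e := map_add (fderiv ℝ F 0) !₂[1, 0] !₂[0, 1]
  rw [← key, ← key, ← key] at e
  simpa [F] using e

theorem pairCurve_rel {γ γ' : DMap ℝ X} {δ δ' : DMap ℝ Y} (h : (tangentSetoid X).r γ γ')
    (h' : (tangentSetoid Y).r δ δ') :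
    (tangentSetoid (X × Y)).r (pairCurve γ δ) (pairCurve γ' δ') := by
  refine ⟨Prod.ext h.1 h'.1, fun f => ?_⟩
  change deriv (fun t => f (γ t, δ t)) 0 = deriv (fun t => f (γ' t, δ' t)) 0
  rw [deriv_pair, deriv_pair, ← h.1, ← h'.1]
  congr 1
  · exact h.2 ⟨fun x => f (x, δ 0), fun _ p hp => f.2 _ (fun w => (p w, δ 0)) ⟨hp, isPlot_const⟩⟩
  · exact h'.2 ⟨fun y => f (γ 0, y), fun _ p hp => f.2 _ (fun w => (γ 0, p w)) ⟨isPlot_const, hp⟩⟩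

/-- The canonical map `TX × TY → T(X × Y)`, `([γ], [δ]) ↦ [t ↦ (γ t, δ t)]`. -/
def Tangent.pair : Tangent X → Tangent Y → Tangent (X × Y) :=
  Quotient.map₂ (sa := tangentSetoid X) (sb := tangentSetoid Y) (sc := tangentSetoid (X × Y))
    pairCurve (fun _ _ h _ _ h' => pairCurve_rel h h')

/-- The smooth curve `t ↦ (γ₁ t, …, γₙ t)`. -/
def tupleCurve {n : ℕ} {X : Fin n → Type*} [∀ i, DiffeologicalSpace (X i)]
    (γ : ∀ i, DMap ℝ (X i)) : DMap ℝ (∀ i, X i) :=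
  ⟨fun t i => γ i t, fun _ p hp i => (γ i).2 _ p hp⟩

/-- The smooth map `(x, y) ↦ (x, y₁, …, yₙ)`. -/
def consMap {n : ℕ} (X : Fin (n + 1) → Type*) [∀ i, DiffeologicalSpace (X i)] :
    DMap (X 0 × ∀ i : Fin n, X i.succ) (∀ i, X i) :=
  ⟨fun z => Fin.cons z.1 z.2, fun _ _ hp i => by
    refine Fin.cases ?_ (fun j => ?_) i
    · exact hp.1
    · exact hp.2 j⟩

/-- The canonical map `TX₁ × ⋯ × TXₙ → T(X₁ × ⋯ × Xₙ)`,
`([γ₁], …, [γₙ]) ↦ [t ↦ (γ₁ t, …, γₙ t)]`, in terms of representatives;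
by `Tangent.tuple_mk` their choice does not matter. -/
def Tangent.tuple {n : ℕ} {X : Fin n → Type*} [∀ i, DiffeologicalSpace (X i)]
    (v : ∀ i, Tangent (X i)) : Tangent (∀ i, X i) :=
  Tangent.mk (tupleCurve fun i => Quotient.out (v i))

theorem tupleCurve_rel : ∀ {n : ℕ} {X : Fin n → Type*} [∀ i, DiffeologicalSpace (X i)]
    {γ δ : ∀ i, DMap ℝ (X i)}, (∀ i, (tangentSetoid (X i)).r (γ i) (δ i)) →
    (tangentSetoid (∀ i, X i)).r (tupleCurve γ) (tupleCurve δ)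
  | 0, X, _, γ, δ, _ => by
    have : tupleCurve γ = tupleCurve δ := Subtype.ext (funext fun t => funext fun i => i.elim0)
    exact this ▸ ⟨rfl, fun _ => rfl⟩
  | n + 1, X, _, γ, δ, h => by
    have e : ∀ γ : ∀ i, DMap ℝ (X i), tupleCurve γ =
        (consMap X).comp (pairCurve (γ 0) (tupleCurve fun i : Fin n => γ i.succ)) := by
      intro γ
      refine Subtype.ext (funext fun t => funext fun i => ?_)
      refine Fin.cases ?_ (fun j => ?_) i
      · rfl
      · rfl
    have r := pairCurve_rel (h 0) (tupleCurve_rel fun i : Fin n => h i.succ)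
    rw [e γ, e δ]
    exact ⟨congrArg (consMap X).1 r.1, fun g => r.2 (g.comp (consMap X))⟩

theorem Tangent.tuple_mk {n : ℕ} {X : Fin n → Type*} [∀ i, DiffeologicalSpace (X i)]
    (γ : ∀ i, DMap ℝ (X i)) :
    Tangent.tuple (fun i => Tangent.mk (γ i)) = Tangent.mk (tupleCurve γ) :=
  Quotient.sound (s := tangentSetoid (∀ i, X i)) (tupleCurve_rel fun i =>
    Quotient.exact (s := tangentSetoid (X i)) (Quotient.out_eq _))

end Tangent

/-! ### The language -/

/-- Types: reals, `n`-ary products, functions, variants with `n` constructors, lists.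
The constructors of a variant are named by their positions. -/
inductive Ty : Type
  | real : Ty
  | prod (n : ℕ) (σ : Fin n → Ty) : Ty
  | fn (σ τ : Ty) : Ty
  | variant (n : ℕ) (σ : Fin n → Ty) : Ty
  | list (τ : Ty) : Ty

/-- First order types: those without function types. -/
def Ty.FirstOrder : Ty → Prop
  | .real => True
  | .prod _ σ => ∀ i, (σ i).FirstOrder
  | .fn _ _ => False
  | .variant _ σ => ∀ i, (σ i).FirstOrder
  | .list τ => τ.FirstOrder

/-- Contexts, built up by one typed variable or by a block of `n` typed variables at a time. -/
inductive Ctx : Type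
  | nil : Ctx
  | snoc (Γ : Ctx) (τ : Ty) : Ctx
  | block (Γ : Ctx) (n : ℕ) (σ : Fin n → Ty) : Ctx

/-- First order contexts: all variables have first order types. -/
def Ctx.FirstOrder : Ctx → Prop
  | .nil => True
  | .snoc Γ τ => Γ.FirstOrder ∧ τ.FirstOrder
  | .block Γ _ σ => Γ.FirstOrder ∧ ∀ i, (σ i).FirstOrder

/-- `Var Γ τ`: the variables of type `τ` in `Γ`. -/
inductive Var : Ctx → Ty → Type
  | last {Γ : Ctx} {τ : Ty} : Var (Γ.snoc τ) τ
  | skip {Γ : Ctx} {σ τ : Ty} (x : Var Γ τ) : Var (Γ.snoc σ) τ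
  | inBlock {Γ : Ctx} {n : ℕ} {σ : Fin n → Ty} (i : Fin n) : Var (Γ.block n σ) (σ i)
  | skipBlock {Γ : Ctx} {n : ℕ} {σ : Fin n → Ty} {τ : Ty} (x : Var Γ τ) : Var (Γ.block n σ) τ

/-- A family of basic operations `ℝⁿ → ℝ`, interpreted by smooth functions; they come in addition
to the constants, `+`, `*` and the sigmoid function. -/
structure Ops where
  Op : ℕ → Type u
  interp : ∀ {n : ℕ}, Op n → (Fin n → ℝ) → ℝ
  smooth : ∀ {n : ℕ} (o : Op n), ContDiff ℝ ∞ (interp o)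

/-- `Term O Γ τ`: the well-typed terms `Γ ⊢ t : τ`. -/
inductive Term (O : Ops.{u}) : Ctx → Ty → Type u
  | var {Γ : Ctx} {τ : Ty} (x : Var Γ τ) : Term O Γ τ
  | const {Γ : Ctx} (c : ℝ) : Term O Γ .real
  | add {Γ : Ctx} (t s : Term O Γ .real) : Term O Γ .real
  | mul {Γ : Ctx} (t s : Term O Γ .real) : Term O Γ .real
  | sigmoid {Γ : Ctx} (t : Term O Γ .real) : Term O Γ .real
  | op {Γ : Ctx} {n : ℕ} (o : O.Op n) (t : Fin n → Term O Γ .real) : Term O Γ .real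
  /-- `⟨t₁, …, tₙ⟩` -/
  | tuple {Γ : Ctx} {n : ℕ} {σ : Fin n → Ty} (t : ∀ i, Term O Γ (σ i)) : Term O Γ (.prod n σ)
  /-- `case t of ⟨x₁, …, xₙ⟩ → s` -/
  | split {Γ : Ctx} {n : ℕ} {σ : Fin n → Ty} {τ : Ty} (t : Term O Γ (.prod n σ))
      (s : Term O (Γ.block n σ) τ) : Term O Γ τ
  | lam {Γ : Ctx} {σ τ : Ty} (t : Term O (Γ.snoc σ) τ) : Term O Γ (.fn σ τ)
  | app {Γ : Ctx} {σ τ : Ty} (t : Term O Γ (.fn σ τ)) (s : Term O Γ σ) : Term O Γ τ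
  | inj {Γ : Ctx} {n : ℕ} {σ : Fin n → Ty} (i : Fin n) (t : Term O Γ (σ i)) :
      Term O Γ (.variant n σ)
  /-- `case t of {ℓ₁ x₁ → s₁ | ⋯ | ℓₙ xₙ → sₙ}` -/
  | cases {Γ : Ctx} {n : ℕ} {σ : Fin n → Ty} {τ : Ty} (t : Term O Γ (.variant n σ))
      (s : ∀ i, Term O (Γ.snoc (σ i)) τ) : Term O Γ τ
  | nil {Γ : Ctx} {τ : Ty} : Term O Γ (.list τ)
  | cons {Γ : Ctx} {τ : Ty} (t : Term O Γ τ) (s : Term O Γ (.list τ)) : Term O Γ (.list τ)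
  /-- `fold (x₁, x₂). t over s from r` -/
  | fold {Γ : Ctx} {σ τ : Ty} (t : Term O ((Γ.snoc τ).snoc σ) σ) (s : Term O Γ (.list τ))
      (r : Term O Γ σ) : Term O Γ σ

/-- Renamings of variables. -/
def Ren (Γ Δ : Ctx) : Type := ∀ τ : Ty, Var Γ τ → Var Δ τ

/-- A renaming under one bound variable. -/
def Ren.snoc {Γ Δ : Ctx} (r : Ren Γ Δ) (σ : Ty) : Ren (Γ.snoc σ) (Δ.snoc σ)
  | _, .last => .last
  | _, .skip x => .skip (r _ x)

/-- A renaming under a block of bound variables. -/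
def Ren.block {Γ Δ : Ctx} (r : Ren Γ Δ) (n : ℕ) (σ : Fin n → Ty) :
    Ren (Γ.block n σ) (Δ.block n σ)
  | _, .inBlock i => .inBlock i
  | _, .skipBlock x => .skipBlock (r _ x)

/-- The action of renamings on terms. -/
def Term.rename {O : Ops.{u}} {Γ : Ctx} {τ : Ty} (t : Term O Γ τ) {Δ : Ctx} (r : Ren Γ Δ) :
    Term O Δ τ :=
  match t with
  | .var x => .var (r _ x)
  | .const c => .const c
  | .add t s => .add (t.rename r) (s.rename r)
  | .mul t s => .mul (t.rename r) (s.rename r)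
  | .sigmoid t => .sigmoid (t.rename r)
  | .op o t => .op o (fun i => (t i).rename r)
  | .tuple t => .tuple (fun i => (t i).rename r)
  | .split t s => .split (t.rename r) (s.rename (r.block _ _))
  | .lam t => .lam (t.rename (r.snoc _))
  | .app t s => .app (t.rename r) (s.rename r)
  | .inj i t => .inj i (t.rename r)
  | .cases t s => .cases (t.rename r) (fun i => (s i).rename (r.snoc _))
  | .nil => .nil
  | .cons t s => .cons (t.rename r) (s.rename r)
  | .fold t s u => .fold (t.rename ((r.snoc _).snoc _)) (s.rename r) (u.rename r)

/-- `let x = t in s`, i.e. `(λ x. s) t`. -/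
def Term.letIn {O : Ops.{u}} {Γ : Ctx} {σ τ : Ty} (t : Term O Γ σ) (s : Term O (Γ.snoc σ) τ) :
    Term O Γ τ := .app (.lam s) t

/-- `t - s`, i.e. `t + (-1) * s`. -/
def Term.sub {O : Ops.{u}} {Γ : Ctx} (t s : Term O Γ .real) : Term O Γ .real :=
  .add t (.mul (.const (-1)) s)

/-- `t₁ + ⋯ + tₙ`. -/
def Term.sum {O : Ops.{u}} {Γ : Ctx} : ∀ {n : ℕ}, (Fin n → Term O Γ .real) → Term O Γ .real
  | 0, _ => .const 0
  | _ + 1, t => .add (t 0) (Term.sum fun i => t i.succ)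

/-! ### Semantics -/

/-- Bundled diffeological spaces. -/
structure DSp where
  carrier : Type
  str : DiffeologicalSpace carrier

instance instDSp (X : DSp) : DiffeologicalSpace X.carrier := X.str

/-- The interpretation of types as diffeological spaces. -/
def Ty.sp : Ty → DSp
  | .real => ⟨ℝ, inferInstance⟩
  | .prod _ σ => ⟨∀ i, (σ i).sp.carrier, inferInstance⟩
  | .fn σ τ => ⟨DMap σ.sp.carrier τ.sp.carrier, inferInstance⟩
  | .variant _ σ => ⟨Σ i, (σ i).sp.carrier, inferInstance⟩
  | .list τ => ⟨List τ.sp.carrier, inferInstance⟩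

/-- The interpretation of contexts as products. -/
def Ctx.sp : Ctx → DSp
  | .nil => ⟨Unit, inferInstance⟩
  | .snoc Γ τ => ⟨Γ.sp.carrier × τ.sp.carrier, inferInstance⟩
  | .block Γ _ σ => ⟨Γ.sp.carrier × ∀ i, (σ i).sp.carrier, inferInstance⟩

/-- The set underlying the interpretation of a type. -/
abbrev Ty.sem (τ : Ty) : Type := τ.sp.carrier

/-- The set underlying the interpretation of a context. -/
abbrev Ctx.sem (Γ : Ctx) : Type := Γ.sp.carrier

section Combinators

variable {X Y Z : Type*} [DiffeologicalSpace X] [DiffeologicalSpace Y] [DiffeologicalSpace Z]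

/-- Pairing. -/
def DMap.pair (f : DMap X Y) (g : DMap X Z) : DMap X (Y × Z) :=
  ⟨fun x => (f x, g x), fun _ p hp => ⟨f.2 _ p hp, g.2 _ p hp⟩⟩

/-- Tupling. -/
def DMap.tuple {ι : Type*} {Y : ι → Type*} [∀ i, DiffeologicalSpace (Y i)]
    (f : ∀ i, DMap X (Y i)) : DMap X (∀ i, Y i) :=
  ⟨fun x i => f i x, fun _ p hp i => (f i).2 _ p hp⟩

/-- Currying. -/
def DMap.curry (f : DMap (X × Y) Z) : DMap X (DMap Y Z) :=
  ⟨fun x => ⟨fun y => f (x, y), fun _ p hp => f.2 _ (fun w => (x, p w)) ⟨isPlot_const, hp⟩⟩,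
    fun _ p hp _ q hq => f.2 _ (fun w => (p (q w).1, (q w).2))
      ⟨isPlot_reparam hp hq.1.contDiff, hq.2⟩⟩

/-- Application. -/
def DMap.ap (f : DMap X (DMap Y Z)) (g : DMap X Y) : DMap X Z :=
  ⟨fun x => f x (g x), fun n p hp =>
    f.2 _ p hp n (fun w => (w, g (p w))) ⟨isPlot_id, g.2 _ p hp⟩⟩

/-- Case distinction. -/
def DMap.cases {ι : Type*} {Y : ι → Type*} [∀ i, DiffeologicalSpace (Y i)]
    (f : DMap X (Σ i, Y i)) (g : ∀ i, DMap (X × Y i) Z) : DMap X Z :=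
  ⟨fun x => g (f x).1 (x, (f x).2), fun n p hp => by
    obtain ⟨i, q, hq, he⟩ := f.2 _ p hp
    have : (fun x => g (f x).1 (x, (f x).2)) ∘ p = fun w => g i (p w, q w) := by
      funext w
      have h : f (p w) = ⟨i, q w⟩ := congrFun he w
      simp only [Function.comp_apply]
      rw [h]
    rw [this]
    exact (g i).2 _ (fun w => (p w, q w)) ⟨hp, hq⟩⟩

/-- Adding an element to a list. -/
def DMap.cons (f : DMap X Y) (g : DMap X (List Y)) : DMap X (List Y) :=
  ⟨fun x => f x :: g x, fun n p hp => by
    obtain ⟨k, q, hq, he⟩ := isPlot_list_iff.1 (g.2 _ p hp)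
    refine isPlot_list_iff.2 ⟨k + 1, fun w => Fin.cons (f (p w)) (q w), fun i => ?_, ?_⟩
    · refine Fin.cases ?_ (fun j => ?_) i
      · exact f.2 _ p hp
      · exact hq j
    · funext w
      have h : g (p w) = List.ofFn (q w) := congrFun he w
      simp [h, List.ofFn_succ]⟩

/-- Folding over a list, from the right. -/
def DMap.fold (f : DMap ((X × Y) × Z) Z) (g : DMap X (List Y)) (h : DMap X Z) : DMap X Z :=
  ⟨fun x => (g x).foldr (fun a b => f ((x, a), b)) (h x), fun n p hp => by
    obtain ⟨k, q, hq, he⟩ := isPlot_list_iff.1 (g.2 _ p hp)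
    have key : ∀ (k : ℕ) (q : E n → Fin k → Y), (∀ i, IsPlot (fun w => q w i)) →
        IsPlot (fun w => (List.ofFn (q w)).foldr (fun a b => f ((p w, a), b)) (h (p w))) := by
      intro k
      induction k with
      | zero => intro q _; exact h.2 _ p hp
      | succ k ih =>
        intro q hq
        simp only [List.ofFn_succ, List.foldr_cons]
        exact f.2 _ (fun w => ((p w, q w 0), _))
          ⟨⟨hp, hq 0⟩, ih (fun w i => q w i.succ) (fun i => hq i.succ)⟩
    have e : (fun x => (g x).foldr (fun a b => f ((x, a), b)) (h x)) ∘ p =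
        fun w => (List.ofFn (q w)).foldr (fun a b => f ((p w, a), b)) (h (p w)) := by
      funext w
      have h' : g (p w) = List.ofFn (q w) := congrFun he w
      simp only [Function.comp_apply]
      rw [h']
    rw [e]
    exact key k q hq⟩

/-- Smooth functions of several real variables, for the product diffeology. -/
def DMap.ofContDiff {n : ℕ} (f : (Fin n → ℝ) → ℝ) (hf : ContDiff ℝ ∞ f) : DMap (Fin n → ℝ) ℝ :=
  ⟨f, fun _ _ hp => (hf.comp (contDiff_pi.2 fun i => (hp i).contDiff)).isPlot⟩

/-- Addition. -/
def DMap.add (f g : DMap X ℝ) : DMap X ℝ :=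
  ⟨fun x => f x + g x, fun _ p hp => ((f.2 _ p hp).contDiff.add (g.2 _ p hp).contDiff).isPlot⟩

/-- Multiplication. -/
def DMap.mul (f g : DMap X ℝ) : DMap X ℝ :=
  ⟨fun x => f x * g x, fun _ p hp => ((f.2 _ p hp).contDiff.mul (g.2 _ p hp).contDiff).isPlot⟩

/-- The sigmoid function `x ↦ 1 / (1 + exp (-x))`. -/
def DMap.sigmoid (f : DMap X ℝ) : DMap X ℝ :=
  ⟨fun x => Real.sigmoid (f x), fun _ p hp =>
    ((contDiff_sigmoid.of_le le_top).comp (f.2 _ p hp).contDiff).isPlot⟩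

/-- Constant maps. -/
def DMap.const (y : Y) : DMap X Y := ⟨fun _ => y, dSmooth_const⟩

end Combinators

/-- The interpretation of variables as projections. -/
def Var.sem {Γ : Ctx} {τ : Ty} (x : Var Γ τ) : DMap Γ.sem τ.sem :=
  match x with
  | .last => ⟨fun ρ => ρ.2, fun _ _ hp => hp.2⟩
  | .skip x => ⟨fun ρ => x.sem ρ.1, fun _ p hp => x.sem.2 _ (fun w => (p w).1) hp.1⟩
  | .inBlock (σ := _) i => ⟨fun ρ => ρ.2 i, fun _ _ hp => hp.2 i⟩
  | .skipBlock x => ⟨fun ρ => x.sem ρ.1, fun _ p hp => x.sem.2 _ (fun w => (p w).1) hp.1⟩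

/-- The interpretation of terms as smooth maps. -/
def Term.sem {O : Ops.{u}} : ∀ {Γ : Ctx} {τ : Ty}, Term O Γ τ → DMap Γ.sem τ.sem
  | _, _, .var x => x.sem
  | _, _, .const c => DMap.const (Y := ℝ) c
  | _, _, .add t s => DMap.add t.sem s.sem
  | _, _, .mul t s => DMap.mul t.sem s.sem
  | _, _, .sigmoid t => DMap.sigmoid t.sem
  | _, _, .op o t => (DMap.ofContDiff (O.interp o) (O.smooth o)).comp (DMap.tuple fun i => (t i).sem)
  | _, _, .tuple t => DMap.tuple fun i => (t i).sem
  | _, _, .split t s => s.sem.comp (DMap.pair ⟨fun ρ => ρ, dSmooth_id⟩ t.sem)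
  | _, _, .lam t => t.sem.curry
  | _, _, .app t s => t.sem.ap s.sem
  | _, _, .inj i t => (injMap i).comp t.sem
  | _, _, .cases t s => t.sem.cases fun i => (s i).sem
  | _, _, .nil (τ := τ) => DMap.const (Y := List τ.sem) []
  | _, _, .cons t s => t.sem.cons s.sem
  | _, _, .fold t s r => t.sem.fold s.sem r.sem

/-! ### Forward mode automatic differentiation -/

/-- The macro on types. -/
def Ty.D : Ty → Ty
  | .real => .prod 2 (fun _ => .real)
  | .prod n σ => .prod n (fun i => (σ i).D)
  | .fn σ τ => .fn σ.D τ.D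
  | .variant n σ => .variant n (fun i => (σ i).D)
  | .list τ => .list τ.D

/-- The macro on contexts. -/
def Ctx.D : Ctx → Ctx
  | .nil => .nil
  | .snoc Γ τ => .snoc Γ.D τ.D
  | .block Γ n σ => .block Γ.D n (fun i => (σ i).D)

/-- The macro on variables. -/
def Var.D {Γ : Ctx} {τ : Ty} (x : Var Γ τ) : Var Γ.D τ.D :=
  match x with
  | .last => .last
  | .skip x => .skip x.D
  | .inBlock (σ := σ) i => .inBlock (σ := fun i => (σ i).D) i
  | .skipBlock x => .skipBlock x.D

/-- The context `x₁ : real, …, xₙ : real`. -/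
abbrev realCtx (n : ℕ) : Ctx := Ctx.nil.block n (fun _ => .real)

/-- A choice of terms `x₁, …, xₙ : real ⊢ ∂ᵢ op : real` for the basic operations. -/
abbrev Partials (O : Ops.{u}) : Type u :=
  ∀ (n : ℕ), O.Op n → Fin n → Term O (realCtx n) .real

/-- The chosen terms denote the partial derivatives of the operations. -/
def Partials.Correct {O : Ops.{u}} (pd : Partials O) : Prop :=
  ∀ (n : ℕ) (o : O.Op n) (i : Fin n) (x : Fin n → ℝ),
    (pd n o i).sem ((), x) = deriv (fun s : ℝ => O.interp o (Function.update x i s)) (x i)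

/-- `Γ, x₁ : real, x₁' : real, …, xₖ : real, xₖ' : real`. -/
def pairsCtx (Γ : Ctx) : ℕ → Ctx
  | 0 => Γ
  | k + 1 => (pairsCtx Γ k).block 2 (fun _ => .real)

/-- The variables `xᵢ` (for `j = 0`) and `xᵢ'` (for `j = 1`) of `pairsCtx Γ k`. -/
def pairsVar {Γ : Ctx} : ∀ {k : ℕ}, Fin k → Fin 2 → Var (pairsCtx Γ k) .real
  | 0, i, _ => i.elim0
  | k + 1, i, j => Fin.lastCases (motive := fun _ => Var (pairsCtx Γ (k + 1)) .real)
      (.inBlock (σ := fun _ => .real) j) (fun i' => .skipBlock (pairsVar i' j)) i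

/-- Weakening from `Γ` to `pairsCtx Γ k`. -/
def pairsWk {Γ : Ctx} : ∀ k : ℕ, Ren Γ (pairsCtx Γ k)
  | 0, _, x => x
  | k + 1, _, x => .skipBlock (pairsWk k _ x)

/-- `case t₁ of ⟨x₁, x₁'⟩ → ⋯ → case tₖ of ⟨xₖ, xₖ'⟩ → s`. -/
def splitPairs {O : Ops.{u}} {Γ : Ctx} {τ : Ty} : ∀ {k : ℕ},
    (Fin k → Term O Γ (.prod 2 (fun _ => .real))) → Term O (pairsCtx Γ k) τ → Term O Γ τ
  | 0, _, s => s
  | k + 1, t, s => splitPairs (fun i => t i.castSucc)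
      (.split ((t (Fin.last k)).rename (pairsWk k)) s)

/-- The renaming of the variables of `realCtx n` to the variables `xᵢ` of `pairsCtx Γ n`. -/
def pairsRen {Γ : Ctx} {n : ℕ} : Ren (realCtx n) (pairsCtx Γ n)
  | _, .inBlock i => pairsVar i 0

/-- `⟨t, s⟩ : real * real`. -/
def Term.dual {O : Ops.{u}} {Γ : Ctx} (t s : Term O Γ .real) :
    Term O Γ (.prod 2 (fun _ => .real)) :=
  .tuple ![t, s]

/-- The macro on terms. -/
def Term.D {O : Ops.{u}} (pd : Partials O) {Γ : Ctx} {τ : Ty} (t : Term O Γ τ) : Term O Γ.D τ.D :=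
  match t with
  | .var x => .var x.D
  | .const c => .dual (.const c) (.const 0)
  | .add t s => splitPairs ![t.D pd, s.D pd]
      (let x := .var (pairsVar 0 0)
       let x' := .var (pairsVar 0 1)
       let y := .var (pairsVar 1 0)
       let y' := .var (pairsVar 1 1)
       .dual (.add x y) (.add x' y'))
  | .mul t s => splitPairs ![t.D pd, s.D pd]
      (let x := .var (pairsVar 0 0)
       let x' := .var (pairsVar 0 1)
       let y := .var (pairsVar 1 0)
       let y' := .var (pairsVar 1 1)
       .dual (.mul x y) (.add (.mul x y') (.mul x' y)))
  | .sigmoid t => splitPairs ![t.D pd]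
      (.letIn (.sigmoid (.var (pairsVar 0 0)))
        (let x' := .var (.skip (pairsVar 0 1))
         let y := .var .last
         .dual y (.mul (.mul x' y) (.sub (.const 1) y))))
  | .op o t => splitPairs (fun i => (t i).D pd)
      (.dual (.op o (fun i => .var (pairsVar i 0)))
        (.sum fun i => .mul (.var (pairsVar i 1)) ((pd _ o i).rename pairsRen)))
  | .tuple t => .tuple (fun i => (t i).D pd)
  | .split t s => .split (t.D pd) (s.D pd)
  | .lam t => .lam (t.D pd)
  | .app t s => .app (t.D pd) (s.D pd)
  | .inj (σ := σ) i t => .inj (σ := fun i => (σ i).D) i (t.D pd)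
  | .cases t s => .cases (t.D pd) (fun i => (s i).D pd)
  | .nil => .nil
  | .cons t s => .cons (t.D pd) (s.D pd)
  | .fold t s r => .fold (t.D pd) (s.D pd) (r.D pd)

/-! ### The canonical isomorphisms -/

/-- The line `t ↦ x + x' t` in `ℝ`. -/
def realLine (x x' : ℝ) : DMap ℝ ℝ :=
  ⟨fun t => x + x' * t, ContDiff.dSmooth (by fun_prop)⟩

/-- The canonical isomorphism `⟦D τ⟧ ≅ T⟦τ⟧` at a first order type `τ`. -/
def Ty.toTangent : ∀ τ : Ty, τ.FirstOrder → τ.D.sem → Tangent τ.sem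
  | .real, _, a => Tangent.mk (realLine (a 0) (a 1))
  | .prod _ σ, h, a => Tangent.tuple fun i => (σ i).toTangent (h i) (a i)
  | .fn _ _, h, _ => h.elim
  | .variant _ σ, h, a => Tangent.map (injMap a.1) ((σ a.1).toTangent (h a.1) a.2)
  | .list τ, h, a =>
    Tangent.map (listMap (List.length a)) (Tangent.tuple fun i => τ.toTangent h (List.get a i))

/-- The canonical isomorphism `⟦D Γ⟧ ≅ T⟦Γ⟧` at a first order context `Γ`. -/
def Ctx.toTangent : ∀ Γ : Ctx, Γ.FirstOrder → Γ.D.sem → Tangent Γ.sem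
  | .nil, _, _ => Tangent.mk (DMap.const (Y := Unit) ())
  | .snoc Γ τ, h, a => Tangent.pair (Γ.toTangent h.1 a.1) (τ.toTangent h.2 a.2)
  | .block Γ _ σ, h, a =>
    Tangent.pair (Γ.toTangent h.1 a.1) (Tangent.tuple fun i => (σ i).toTangent (h.2 i) (a.2 i))

end AD

end

open AD

noncomputable section

namespace AD

/-! Two independent arguments meet at the end: one about the spaces, one about the terms.

Spaces. Every first order type denotes a countable disjoint union of finite dimensional vector
spaces: this holds for the real line and the point and is preserved by finite products, countable
sums and lists. A plot has a connected domain, so it factors globally through one summand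
(`IsVectorSum`). Hence the space is a manifold whose summands are charts, and each tangent vector is
the class of exactly one straight line `t ↦ x + t v` in one summand: the chain rule shows that each
curve is tangent to such a line, and coordinate functions extended by zero separate the lines. The
tangent bundle is thus the disjoint union of the `V s × V s`. A `TangentModel` records that the
canonical map realises this identification; models are built by recursion on types and contexts and
give the manifold and diffeomorphism claims.

Terms. Induction on `t` cannot prove the equation directly, because subterms may have function
types, where there is no canonical map to a tangent bundle. It is replaced by a logical relation
between curves in `⟦τ⟧` and curves in `⟦D τ⟧`: at `real` the second curve is the first together with
its derivative, at function types related arguments go to related results, and elsewhere the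
relation is componentwise. The fundamental lemma `Term.rel_sem` says that `(⟦t⟧, ⟦D t⟧)` preserves
the relation; the cases of the basic operations are the sum, product and chain rules.

At first order types, related curves `(f, g)` satisfy `φ (g 0) = [f]` (`Ty.Rel.toTangent`), and
every point of `⟦D Γ⟧` is `g 0` for some related pair (`Ctx.exists_rel`). So for `ρ = g 0` one gets
`φ_τ (⟦D t⟧ ρ) = [⟦t⟧ ∘ f] = T⟦t⟧ [f] = T⟦t⟧ (φ_Γ ρ)`. -/

/-! ### Disjoint unions of finite dimensional vector spaces -/

/-- `X` is the disjoint union of the vector spaces `V s`, with inclusions `ψ s`. -/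
structure IsVectorSum {S X : Type*} [DiffeologicalSpace X] {V : S → Type*}
    [∀ s, NormedAddCommGroup (V s)] [∀ s, NormedSpace ℝ (V s)] (ψ : ∀ s, V s → X) : Prop where
  disjoint : ∀ {s s' x x'}, ψ s x = ψ s' x' → s = s'
  injective : ∀ s, Function.Injective (ψ s)
  isPlot_iff : ∀ {n : ℕ} {p : E n → X},
    IsPlot p ↔ ∃ (s : S) (q : E n → V s), ContDiff ℝ ∞ q ∧ p = fun w => ψ s (q w)

theorem isDiffeo_of_equiv {X Y : Type*} [DiffeologicalSpace X] [DiffeologicalSpace Y] (e : X ≃ Y)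
    (h : DSmooth e) (h' : DSmooth e.symm) : IsDiffeo e :=
  ⟨h, e.symm, h', e.symm_apply_apply, e.apply_symm_apply⟩

namespace IsVectorSum

section

variable {S X : Type*} [DiffeologicalSpace X] {V : S → Type*}
  [∀ s, NormedAddCommGroup (V s)] [∀ s, NormedSpace ℝ (V s)] {ψ : ∀ s, V s → X}

theorem isPlot (h : IsVectorSum ψ) (s : S) {n : ℕ} {q : E n → V s} (hq : ContDiff ℝ ∞ q) :
    IsPlot (fun w => ψ s (q w)) := h.isPlot_iff.2 ⟨s, q, hq, rfl⟩

theorem exists_eq (h : IsVectorSum ψ) (a : X) : ∃ s x, ψ s x = a := by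
  obtain ⟨s, q, -, e⟩ := h.isPlot_iff.1 (isPlot_const (n := 0) (x := a))
  exact ⟨s, q 0, (congrFun e 0).symm⟩

/-- The factorisation supplied by `isPlot_iff` may a priori use another summand; disjointness and
injectivity force it to be `q` itself. -/
theorem contDiff (h : IsVectorSum ψ) {s : S} {n : ℕ} {q : E n → V s}
    (hq : IsPlot (fun w => ψ s (q w))) : ContDiff ℝ ∞ q := by
  obtain ⟨s', q', hq', e⟩ := h.isPlot_iff.1 hq
  obtain rfl := h.disjoint (congrFun e 0)
  have : q = q' := funext fun w => h.injective s (congrFun e w)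
  exact this ▸ hq'

theorem dSmooth (h : IsVectorSum ψ) (s : S) {W : Type*} [NormedAddCommGroup W]
    [NormedSpace ℝ W] [DiffeologicalSpace W] [IsContDiffCompatible W] {c : W → V s}
    (hc : ContDiff ℝ ∞ c) : DSmooth (fun w => ψ s (c w)) :=
  fun _ _ hp => h.isPlot s (hc.comp hp.contDiff)

/-- A smooth curve runs in one of the summands. -/
theorem exists_curve (h : IsVectorSum ψ) (γ : DMap ℝ X) :
    ∃ (s : S) (c : ℝ → V s), ContDiff ℝ ∞ c ∧ ∀ t, γ t = ψ s (c t) := by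
  -- Plots live on the spaces `E n`, so the curve is viewed as a plot on `E 1` and read back along
  -- `t ↦ !₂[t]`.
  obtain ⟨s, q, hq, e⟩ := h.isPlot_iff.1
    (γ.2 1 (fun w => w 0) (ContDiff.isPlot (by fun_prop)))
  refine ⟨s, fun t => q !₂[t], hq.comp ?_, fun t => ?_⟩
  · rw [contDiff_euclidean]
    intro i
    fin_cases i
    exact contDiff_id
  · simpa using congrFun e !₂[t]

/-- The line `t ↦ x + t v` in a summand. -/
def line (h : IsVectorSum ψ) (s : S) (x v : V s) : DMap ℝ X :=
  ⟨fun t => ψ s (x + t • v), h.dSmooth s (by fun_prop)⟩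

theorem line_apply (h : IsVectorSum ψ) (s : S) (x v : V s) (t : ℝ) :
    h.line s x v t = ψ s (x + t • v) := rfl

/-- Serves two purposes: replacing `V s` by `E k`, where charts are defined, and regrouping the
factors of `V s × V s` in products. -/
theorem comp_equiv (h : IsVectorSum ψ) {W : S → Type*} [∀ s, NormedAddCommGroup (W s)]
    [∀ s, NormedSpace ℝ (W s)] (L : ∀ s, W s ≃L[ℝ] V s) :
    IsVectorSum (fun s x => ψ s (L s x)) where
  disjoint e := h.disjoint e
  injective s := (h.injective s).comp (L s).injective
  isPlot_iff {n p} := by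
    rw [h.isPlot_iff]
    constructor
    · rintro ⟨s, q, hq, rfl⟩
      exact ⟨s, fun w => (L s).symm (q w), (L s).symm.contDiff.comp hq, by simp⟩
    · rintro ⟨s, q, hq, rfl⟩
      exact ⟨s, fun w => L s (q w), (L s).contDiff.comp hq, rfl⟩

theorem equiv_comp (h : IsVectorSum ψ) {Y : Type*} [DiffeologicalSpace Y] (e : X ≃ Y)
    (he : DSmooth e) (he' : DSmooth e.symm) : IsVectorSum (fun s x => e (ψ s x)) where
  disjoint h' := h.disjoint (e.injective h')
  injective s := e.injective.comp (h.injective s)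
  isPlot_iff {n p} := by
    constructor
    · intro hp
      obtain ⟨s, q, hq, hpq⟩ := h.isPlot_iff.1 (he' _ _ hp)
      refine ⟨s, q, hq, funext fun w => ?_⟩
      simp [← congrFun hpq w]
    · rintro ⟨s, q, hq, rfl⟩
      exact he _ _ (h.isPlot s hq)

theorem prod (h : IsVectorSum ψ) {S' X' : Type*} [DiffeologicalSpace X'] {V' : S' → Type*}
    [∀ s, NormedAddCommGroup (V' s)] [∀ s, NormedSpace ℝ (V' s)] {ψ' : ∀ s, V' s → X'}
    (h' : IsVectorSum ψ') :
    IsVectorSum (S := S × S') (V := fun s => V s.1 × V' s.2)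
      (fun s x => (ψ s.1 x.1, ψ' s.2 x.2)) where
  disjoint e := Prod.ext (h.disjoint (Prod.ext_iff.1 e).1) (h'.disjoint (Prod.ext_iff.1 e).2)
  injective s _ _ e :=
    Prod.ext (h.injective _ (Prod.ext_iff.1 e).1) (h'.injective _ (Prod.ext_iff.1 e).2)
  isPlot_iff {n p} := by
    constructor
    · rintro ⟨h1, h2⟩
      obtain ⟨s, q, hq, e⟩ := h.isPlot_iff.1 h1
      obtain ⟨s', q', hq', e'⟩ := h'.isPlot_iff.1 h2
      exact ⟨(s, s'), fun w => (q w, q' w), hq.prodMk hq',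
        funext fun w => Prod.ext (congrFun e w) (congrFun e' w)⟩
    · rintro ⟨s, q, hq, rfl⟩
      exact ⟨h.isPlot _ hq.fst, h'.isPlot _ hq.snd⟩

/-- The D-topology is tested on plots. Each inclusion is a plot after choosing Euclidean
coordinates, and every plot is a continuous map followed by an inclusion. -/
theorem isOpen_iff (h : IsVectorSum ψ) [∀ s, FiniteDimensional ℝ (V s)] {U : Set X} :
    IsOpen[dTopology] U ↔ ∀ s, IsOpen (ψ s ⁻¹' U) := by
  rw [isOpen_iff_preimages_plots]
  constructor
  · intro hU s
    have := (hU _ _ (h.isPlot s (toEuclidean (E := V s)).symm.contDiff)).preimage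
      (toEuclidean (E := V s)).continuous
    simpa [← Set.preimage_comp, Function.comp_def] using this
  · intro hU n p hp
    obtain ⟨s, q, hq, rfl⟩ := h.isPlot_iff.1 hp
    exact (hU s).preimage hq.continuous

/-- The bijection of the disjoint union of the summands with the space. -/
def equiv (h : IsVectorSum ψ) : (Σ s, V s) ≃ X :=
  Equiv.ofBijective (fun z => ψ z.1 z.2) ⟨by
    rintro ⟨s, x⟩ ⟨s', x'⟩ e
    obtain rfl : s = s' := h.disjoint e
    exact congrArg _ (h.injective s e), fun a => by
    obtain ⟨s, x, e⟩ := h.exists_eq a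
    exact ⟨⟨s, x⟩, e⟩⟩

/-- In the D-topology, the space is the topological disjoint union of the summands. -/
def homeomorph (h : IsVectorSum ψ) [∀ s, FiniteDimensional ℝ (V s)] :
    letI : TopologicalSpace X := dTopology
    (Σ s, V s) ≃ₜ X :=
  letI : TopologicalSpace X := dTopology
  h.equiv.toHomeomorph fun U => by
    rw [isOpen_sigma_iff]
    exact h.isOpen_iff.symm

theorem t2Space (h : IsVectorSum ψ) [∀ s, FiniteDimensional ℝ (V s)] : @T2Space X dTopology :=
  letI : TopologicalSpace X := dTopology
  h.homeomorph.t2Space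

theorem secondCountableTopology (h : IsVectorSum ψ) [Countable S]
    [∀ s, FiniteDimensional ℝ (V s)] : @SecondCountableTopology X dTopology :=
  letI : TopologicalSpace X := dTopology
  haveI : ∀ s, SecondCountableTopology (V s) := fun s =>
    (toEuclidean (E := V s)).toHomeomorph.secondCountableTopology
  h.homeomorph.symm.secondCountableTopology

end

/-- Products distribute over disjoint unions: a summand of the product is given by a choice of one
summand in every factor. -/
theorem pi {ι : Type*} [Fintype ι] {S : ι → Type*} {X : ι → Type*}
    [∀ i, DiffeologicalSpace (X i)] {V : ∀ i, S i → Type*}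
    [∀ i s, NormedAddCommGroup (V i s)] [∀ i s, NormedSpace ℝ (V i s)]
    {ψ : ∀ i s, V i s → X i} (h : ∀ i, IsVectorSum (ψ i)) :
    IsVectorSum (S := ∀ i, S i) (V := fun s => ∀ i, V i (s i))
      (fun s x i => ψ i (s i) (x i)) where
  disjoint e := funext fun i => (h i).disjoint (congrFun e i)
  injective s _ _ e := funext fun i => (h i).injective _ (congrFun e i)
  isPlot_iff {n p} := by
    constructor
    · intro hp
      choose s q hq e using fun i => (h i).isPlot_iff.1 (hp i)
      exact ⟨s, fun w i => q i w, contDiff_pi.2 hq,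
        funext fun w => funext fun i => congrFun (e i) w⟩
    · rintro ⟨s, q, hq, rfl⟩
      exact fun i => (h i).isPlot _ (contDiff_pi.1 hq i)

theorem sigma {ι : Type*} {S : ι → Type*} {X : ι → Type*}
    [∀ i, DiffeologicalSpace (X i)] {V : ∀ i, S i → Type*}
    [∀ i s, NormedAddCommGroup (V i s)] [∀ i s, NormedSpace ℝ (V i s)]
    {ψ : ∀ i s, V i s → X i} (h : ∀ i, IsVectorSum (ψ i)) :
    IsVectorSum (X := Σ i, X i) (S := Σ i, S i) (V := fun s => V s.1 s.2)
      (fun s x => ⟨s.1, ψ s.1 s.2 x⟩) where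
  disjoint {s s' x x'} e := by
    obtain ⟨i, s⟩ := s
    obtain ⟨i', s'⟩ := s'
    obtain rfl : i = i' := congrArg Sigma.fst e
    exact congrArg _ ((h i).disjoint (eq_of_heq (Sigma.mk.inj e).2))
  injective s _ _ e := (h s.1).injective _ (eq_of_heq (Sigma.mk.inj e).2)
  isPlot_iff {n p} := by
    constructor
    · rintro ⟨i, p, hp, rfl⟩
      obtain ⟨s, q, hq, rfl⟩ := (h i).isPlot_iff.1 hp
      exact ⟨⟨i, s⟩, q, hq, rfl⟩
    · rintro ⟨s, q, hq, rfl⟩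
      exact ⟨s.1, _, (h s.1).isPlot s.2 hq, rfl⟩

/-! ### Charts and tangent vectors of disjoint unions of Euclidean spaces. -/

section Euclidean

variable {S X : Type*} [DiffeologicalSpace X] {k : S → ℕ} {ψ : ∀ s, E (k s) → X}

theorem isChart (h : IsVectorSum ψ) (s : S) : IsChart (ψ s) := by
  refine ⟨h.isPlot s contDiff_id, h.injective s, h.isOpen_iff.2 fun s' => ?_,
    fun n q hq => h.contDiff hq⟩
  -- The range of `ψ s` is open because its preimage in a summand is everything or empty.
  by_cases e : s = s'
  · subst e
    rw [Set.preimage_range]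
    exact isOpen_univ
  · convert isOpen_empty
    refine Set.eq_empty_of_forall_notMem ?_
    rintro x ⟨y, hy⟩
    exact e (h.disjoint hy)

theorem isSmoothManifold [Countable S] (h : IsVectorSum ψ) : IsSmoothManifold X := by
  refine ⟨h.t2Space, h.secondCountableTopology, fun a => ?_⟩
  obtain ⟨s, x, e⟩ := h.exists_eq a
  exact ⟨k s, ψ s, h.isChart s, x, e⟩

/-- The `i`-th coordinate on one summand, extended by zero to the others. -/
def coord (h : IsVectorSum ψ) (s : S) (i : Fin (k s)) : DMap X ℝ := by
  classical
  refine ⟨fun a => if e : ∃ x, ψ s x = a then e.choose i else 0, fun n p hp => ?_⟩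
  -- A plot stays in one summand, so along it the function is either a coordinate of a smooth map or
  -- constantly zero; the two cases of the definition never mix.
  obtain ⟨s', q, hq, rfl⟩ := h.isPlot_iff.1 hp
  by_cases hs : s = s'
  · subst hs
    have : (fun a => if e : ∃ x, ψ s x = a then e.choose i else 0) ∘ (fun w => ψ s (q w)) =
        fun w => q w i := by
      funext w
      have e : ∃ x, ψ s x = ψ s (q w) := ⟨_, rfl⟩
      simp only [Function.comp_apply]
      rw [dif_pos e, h.injective s e.choose_spec]
    rw [this]
    exact ContDiff.isPlot (by fun_prop)
  · have : (fun a => if e : ∃ x, ψ s x = a then e.choose i else 0) ∘ (fun w => ψ s' (q w)) =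
        fun _ => (0 : ℝ) := by
      funext w
      simp only [Function.comp_apply]
      rw [dif_neg]
      rintro ⟨x, hx⟩
      exact hs (h.disjoint hx)
    rw [this]
    exact isPlot_const

open Classical in
theorem coord_apply (h : IsVectorSum ψ) (s : S) (i : Fin (k s)) (x : E (k s)) :
    h.coord s i (ψ s x) = x i := by
  have e : ∃ y, ψ s y = ψ s x := ⟨_, rfl⟩
  have : h.coord s i (ψ s x) = if e : ∃ y, ψ s y = ψ s x then e.choose i else 0 := rfl
  rw [this, dif_pos e, h.injective s e.choose_spec]

theorem contDiff_comp (h : IsVectorSum ψ) (s : S) (f : DMap X ℝ) :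
    ContDiff ℝ ∞ (fun x => f (ψ s x)) :=
  (f.2 _ _ (h.isPlot s contDiff_id)).contDiff

/-- By the chain rule the derivative depends on the curve only through `c 0` and `c'`; this is why a
curve may be replaced by its tangent line. -/
theorem deriv_comp (h : IsVectorSum ψ) {s : S} (f : DMap X ℝ) {c : ℝ → E (k s)} {c' : E (k s)}
    (hc : HasDerivAt c c' 0) :
    deriv (fun t => f (ψ s (c t))) 0 = fderiv ℝ (fun x => f (ψ s x)) (c 0) c' :=
  (((h.contDiff_comp s f).differentiable (by simp) (c 0)).hasFDerivAt.comp_hasDerivAt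
    (0 : ℝ) hc).deriv

theorem hasDerivAt_line {W : Type*} [NormedAddCommGroup W] [NormedSpace ℝ W] (x v : W) :
    HasDerivAt (fun t : ℝ => x + t • v) v 0 := by
  simpa using ((hasDerivAt_id (0 : ℝ)).smul_const v).const_add x

/-- A curve in a summand is tangent to a straight line. -/
theorem mk_eq_mk_line (h : IsVectorSum ψ) {s : S} {c : ℝ → E (k s)} {c' : E (k s)}
    (hc : HasDerivAt c c' 0) {γ : DMap ℝ X} (hγ : ∀ t, γ t = ψ s (c t)) :
    Tangent.mk γ = Tangent.mk (h.line s (c 0) c') := by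
  refine Quotient.sound (s := tangentSetoid X) ⟨?_, fun f => ?_⟩
  · rw [hγ, line_apply, zero_smul, add_zero]
  · simp only [hγ, line_apply]
    rw [h.deriv_comp f hc, h.deriv_comp f (hasDerivAt_line (c 0) c'), zero_smul, add_zero]

/-- The common base point determines the summand and `x`; testing against the extended coordinate
functions then recovers `v`. -/
theorem line_injective (h : IsVectorSum ψ) {s s' : S} {x v : E (k s)} {x' v' : E (k s')}
    (e : Tangent.mk (h.line s x v) = Tangent.mk (h.line s' x' v')) :
    ∃ hs : s = s', hs ▸ x = x' ∧ hs ▸ v = v' := by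
  obtain ⟨h0, h1⟩ := Quotient.exact (s := tangentSetoid X) e
  simp only [line_apply, zero_smul, add_zero] at h0
  obtain rfl := h.disjoint h0
  obtain rfl := h.injective s h0
  refine ⟨rfl, rfl, ?_⟩
  ext i
  have := h1 (h.coord s i)
  simp only [line_apply, coord_apply] at this
  simpa [deriv_const_add] using this

theorem exists_line (h : IsVectorSum ψ) (a : Tangent X) :
    ∃ s x v, a = Tangent.mk (h.line s x v) := by
  induction a using Quotient.inductionOn with
  | h γ =>
    obtain ⟨s, c, hc, e⟩ := h.exists_curve γ
    exact ⟨s, c 0, deriv c 0,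
      h.mk_eq_mk_line (hc.differentiable (by simp) 0).hasDerivAt e⟩

/-- Bijectivity is the unique representation of tangent vectors by lines. Since each `ψ s` is a
chart, `φ ∘ χ s` is built from generating plots of the tangent bundle, so `φ` is smooth; the work
lies in the inverse. -/
theorem isDiffeo (h : IsVectorSum ψ) {Y : Type*} [DiffeologicalSpace Y]
    {χ : ∀ s, E (k s) × E (k s) → Y} (h' : IsVectorSum χ) {φ : Y → Tangent X}
    (hφ : ∀ s x v, φ (χ s (x, v)) = Tangent.mk (h.line s x v)) : IsDiffeo φ := by
  have hb : Function.Bijective φ := by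
    constructor
    · intro a b e
      obtain ⟨s, ⟨x, v⟩, rfl⟩ := h'.exists_eq a
      obtain ⟨s', ⟨x', v'⟩, rfl⟩ := h'.exists_eq b
      rw [hφ, hφ] at e
      obtain ⟨rfl, rfl, rfl⟩ := h.line_injective e
      rfl
    · intro a
      obtain ⟨s, x, v, rfl⟩ := h.exists_line a
      exact ⟨_, hφ s x v⟩
  let e := Equiv.ofBijective φ hb
  have he : ∀ s x v, e.symm (Tangent.mk (h.line s x v)) = χ s (x, v) := fun s x v => by
    rw [← hφ]
    exact e.symm_apply_apply _
  refine isDiffeo_of_equiv e ?_ ?_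
  · intro n p hp
    obtain ⟨s, q, hq, rfl⟩ := h'.isPlot_iff.1 hp
    refine DiffeologicalSpace.isPlot_generatedFrom_of_mem
      ⟨k s, ψ s, h.isChart s, fun w => (q w).1, fun w => (q w).2, hq.fst, hq.snd, ?_⟩
    funext w
    exact hφ s (q w).1 (q w).2
  -- Smoothness of the inverse: `d` is the diffeology of `Y` carried over by the bijection. The
  -- tangent diffeology is the smallest one with its generators, so it suffices that these are plots
  -- of `d`.
  · let d : DiffeologicalSpace (Tangent X) :=
      { plots := fun n => {p | IsPlot (fun w : E n => e.symm (p w))}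
        constant_plots := fun a => isPlot_const (x := e.symm a)
        plot_reparam := fun {n m p f} hp hf =>
          isPlot_reparam (p := fun w => e.symm (p w)) hp hf
        locality := fun {n p} hp =>
          DiffeologicalSpace.locality (p := fun w => e.symm (p w)) hp }
    have hd : instTangent X ≤ d := by
      refine DiffeologicalSpace.generateFrom_le_iff.2 ?_
      rintro n p ⟨l, η, hη, x, v, hx, hv, hp⟩
      obtain ⟨s, g, hg, e'⟩ := h.isPlot_iff.1 hη.1
      change IsPlot (fun w => e.symm (p w))
      -- An arbitrary chart is `η = ψ s ∘ g` with `g` smooth, so its line through `x` with velocity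
      -- `v` is tangent to the line through `g x` with velocity `Dg(x) v`: the usual change of
      -- coordinates on a tangent bundle.
      have key : (fun w => e.symm (p w)) = fun w => χ s (g (x w), fderiv ℝ g (x w) (v w)) := by
        funext w
        have hc : HasDerivAt (fun t : ℝ => g (x w + t • v w)) (fderiv ℝ g (x w) (v w)) 0 := by
          have h2 : HasFDerivAt g (fderiv ℝ g (x w)) (x w + (0 : ℝ) • v w) := by
            simpa using (hg.differentiable (by simp) (x w)).hasFDerivAt
          exact h2.comp_hasDerivAt (0 : ℝ) (hasDerivAt_line (x w) (v w))
        have := h.mk_eq_mk_line hc (γ := chartLine η hη.1 (x w) (v w))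
          (fun t => congrFun e' (x w + t • v w))
        simp only [zero_smul, add_zero] at this
        rw [show p w = _ from congrFun hp w, this, he]
      rw [key]
      refine h'.isPlot s ((hg.comp hx).prodMk ?_)
      exact ((hg.fderiv_right (m := ∞) (by simp)).comp hx).clm_apply hv
    exact fun n p hp => DiffeologicalSpace.le_iff'.1 hd n p hp

end Euclidean

end IsVectorSum

/-! ### Models of tangent bundles -/

/-- `X` is a countable disjoint union of vector spaces `V s`, and `Y` is the disjoint union of the
spaces `V s × V s`, which `φ` identifies with the tangent bundle of `X`. -/
structure TangentModel (X Y : Type) [DiffeologicalSpace X] [DiffeologicalSpace Y]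
    (φ : Y → Tangent X) where
  S : Type
  [countable : Countable S]
  V : S → Type
  [group : ∀ s, NormedAddCommGroup (V s)]
  [space : ∀ s, NormedSpace ℝ (V s)]
  [finite : ∀ s, FiniteDimensional ℝ (V s)]
  ψ : ∀ s, V s → X
  χ : ∀ s, V s × V s → Y
  base : IsVectorSum ψ
  total : IsVectorSum χ
  map_eq : ∀ s x v, φ (χ s (x, v)) = Tangent.mk (base.line s x v)

attribute [instance] TangentModel.countable TangentModel.group TangentModel.space
  TangentModel.finite

namespace TangentModel

section

variable {X Y : Type} [DiffeologicalSpace X] [DiffeologicalSpace Y] {φ : Y → Tangent X}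

/-- Coordinates on the summands. -/
def coordinates (M : TangentModel X Y φ) (s : M.S) :
    E (Module.finrank ℝ (M.V s)) ≃L[ℝ] M.V s :=
  ContinuousLinearEquiv.ofFinrankEq (by simp)

theorem isSmoothManifold (M : TangentModel X Y φ) : IsSmoothManifold X :=
  (M.base.comp_equiv M.coordinates).isSmoothManifold

theorem isDiffeo (M : TangentModel X Y φ) : IsDiffeo φ := by
  refine (M.base.comp_equiv M.coordinates).isDiffeo
    (M.total.comp_equiv fun s => (M.coordinates s).prodCongr (M.coordinates s)) fun s x v => ?_
  refine (M.map_eq s _ _).trans (congrArg Tangent.mk (Subtype.ext (funext fun t => ?_)))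
  change M.ψ s _ = M.ψ s _
  simp

/-- Transport along diffeomorphisms. -/
def transport (M : TangentModel X Y φ) {X' Y' : Type} [DiffeologicalSpace X']
    [DiffeologicalSpace Y'] (e : X ≃ X') (he : DSmooth e) (he' : DSmooth e.symm)
    (g : Y ≃ Y') (hg : DSmooth g) (hg' : DSmooth g.symm) (φ' : Y' → Tangent X')
    (h : ∀ y, φ' y = Tangent.map ⟨e, he⟩ (φ (g.symm y))) : TangentModel X' Y' φ' where
  S := M.S
  V := M.V
  ψ s x := e (M.ψ s x)
  χ s x := g (M.χ s x)
  base := M.base.equiv_comp e he he'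
  total := M.total.equiv_comp g hg hg'
  map_eq s x v := by
    rw [h, g.symm_apply_apply, M.map_eq]
    rfl

/-- Binary products. -/
def prod (M : TangentModel X Y φ) {X' Y' : Type} [DiffeologicalSpace X']
    [DiffeologicalSpace Y'] {φ' : Y' → Tangent X'} (M' : TangentModel X' Y' φ') :
    TangentModel (X × X') (Y × Y') (fun y => Tangent.pair (φ y.1) (φ' y.2)) where
  S := M.S × M'.S
  V s := M.V s.1 × M'.V s.2
  ψ s x := (M.ψ s.1 x.1, M'.ψ s.2 x.2)
  χ s z := (M.χ s.1 (z.1.1, z.2.1), M'.χ s.2 (z.1.2, z.2.2))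
  base := M.base.prod M'.base
  -- Positions and velocities are grouped by factor in the product of the models, but must form one
  -- position and one velocity of the product.
  total := (M.total.prod M'.total).comp_equiv
    fun s => ContinuousLinearEquiv.prodProdProdComm ℝ _ _ _ _
  map_eq s x v := by
    change Tangent.pair (φ (M.χ _ _)) (φ' (M'.χ _ _)) = _
    rw [M.map_eq, M'.map_eq]
    rfl

end

/-- The real line. -/
def real : TangentModel ℝ (Fin 2 → ℝ) (fun a => Tangent.mk (realLine (a 0) (a 1))) where
  S := Unit
  V _ := ℝ
  ψ _ x := x
  χ _ z := ![z.1, z.2]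
  base :=
    { disjoint := fun _ => rfl
      injective := fun _ => Function.injective_id
      isPlot_iff := fun {n p} => ⟨fun hp => ⟨(), p, hp.contDiff, rfl⟩, by
        rintro ⟨_, q, hq, rfl⟩
        exact hq.isPlot⟩ }
  total :=
    { disjoint := fun _ => rfl
      injective := fun _ a b e => Prod.ext (congrFun e 0) (congrFun e 1)
      isPlot_iff := fun {n p} => by
        constructor
        · intro hp
          refine ⟨(), fun w => (p w 0, p w 1), (hp 0).contDiff.prodMk (hp 1).contDiff,
            funext fun w => funext fun i => ?_⟩
          fin_cases i
          · rfl
          · rfl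
        · rintro ⟨_, q, hq, rfl⟩ i
          fin_cases i
          · exact hq.fst.isPlot
          · exact hq.snd.isPlot }
  map_eq s x v := congrArg Tangent.mk (Subtype.ext (funext fun t => by
    change x + v * t = x + t * v
    rw [mul_comm]))

/-- The point. -/
def unit : TangentModel Unit Unit (fun _ => Tangent.mk (DMap.const (Y := Unit) ())) where
  S := Unit
  V _ := E 0
  ψ _ _ := ()
  χ _ _ := ()
  base :=
    { disjoint := fun _ => rfl
      injective := fun _ a b _ => Subsingleton.elim a b
      isPlot_iff := ⟨fun _ => ⟨(), fun _ => 0, contDiff_const, rfl⟩,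
        fun _ => trivial⟩ }
  total :=
    { disjoint := fun _ => rfl
      injective := fun _ a b _ => Subsingleton.elim a b
      isPlot_iff := ⟨fun _ => ⟨(), fun _ => 0, contDiff_const, rfl⟩,
        fun _ => trivial⟩ }
  map_eq _ _ _ := rfl

/-- The interchange `(∏ᵢ Vᵢ) × (∏ᵢ Wᵢ) ≃ ∏ᵢ (Vᵢ × Wᵢ)`. -/
def piProd {ι : Type*} (V : ι → Type*) [∀ i, NormedAddCommGroup (V i)]
    [∀ i, NormedSpace ℝ (V i)] :
    ((∀ i, V i) × (∀ i, V i)) ≃L[ℝ] ∀ i, V i × V i where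
  toFun z i := (z.1 i, z.2 i)
  invFun z := (fun i => (z i).1, fun i => (z i).2)
  map_add' _ _ := rfl
  map_smul' _ _ := rfl
  left_inv _ := rfl
  right_inv _ := rfl
  continuous_toFun := by fun_prop
  continuous_invFun := by fun_prop

/-- Finite products. -/
def pi {n : ℕ} {X Y : Fin n → Type} [∀ i, DiffeologicalSpace (X i)]
    [∀ i, DiffeologicalSpace (Y i)] {φ : ∀ i, Y i → Tangent (X i)}
    (M : ∀ i, TangentModel (X i) (Y i) (φ i)) :
    TangentModel (∀ i, X i) (∀ i, Y i) (fun y => Tangent.tuple fun i => φ i (y i)) where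
  S := ∀ i, (M i).S
  V s := ∀ i, (M i).V (s i)
  ψ s x i := (M i).ψ (s i) (x i)
  χ s z i := (M i).χ (s i) (z.1 i, z.2 i)
  base := IsVectorSum.pi fun i => (M i).base
  total := (IsVectorSum.pi fun i => (M i).total).comp_equiv
    fun s => piProd fun i => (M i).V (s i)
  map_eq s x v := by
    -- The tuple map is defined by chosen representatives; `Tangent.tuple_mk` permits the lines
    -- instead, and a tuple of lines is a line.
    simp only [(M _).map_eq]
    exact Tangent.tuple_mk _

/-- Disjoint unions. -/
def sigma {ι : Type} [Countable ι] {X Y : ι → Type} [∀ i, DiffeologicalSpace (X i)]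
    [∀ i, DiffeologicalSpace (Y i)] {φ : ∀ i, Y i → Tangent (X i)}
    (M : ∀ i, TangentModel (X i) (Y i) (φ i)) :
    TangentModel (Σ i, X i) (Σ i, Y i) (fun y => Tangent.map (injMap y.1) (φ y.1 y.2)) where
  S := Σ i, (M i).S
  V s := (M s.1).V s.2
  ψ s x := ⟨s.1, (M s.1).ψ s.2 x⟩
  χ s z := ⟨s.1, (M s.1).χ s.2 z⟩
  base := IsVectorSum.sigma fun i => (M i).base
  total := IsVectorSum.sigma fun i => (M i).total
  map_eq s x v := by
    change Tangent.map (injMap s.1) (φ s.1 ((M s.1).χ s.2 (x, v))) = _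
    rw [(M s.1).map_eq]
    rfl

theorem dSmooth_equivSigmaTuple (X : Type*) [DiffeologicalSpace X] :
    DSmooth (List.equivSigmaTuple (α := X)) := fun _ _ hp => hp

theorem dSmooth_equivSigmaTuple_symm (X : Type*) [DiffeologicalSpace X] :
    DSmooth (List.equivSigmaTuple (α := X)).symm := by
  intro n p hp
  change IsPlot (fun u => List.equivSigmaTuple (List.equivSigmaTuple.symm (p u)))
  simp only [Equiv.apply_symm_apply]
  exact hp

/-- Lists. -/
def list {X Y : Type} [DiffeologicalSpace X] [DiffeologicalSpace Y] {φ : Y → Tangent X}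
    (M : TangentModel X Y φ) :
    TangentModel (List X) (List Y) (fun a =>
      Tangent.map (listMap a.length) (Tangent.tuple fun i => φ (a.get i))) :=
  -- A list is its length together with the tuple of its entries.
  (sigma fun k : ℕ => pi fun _ : Fin k => M).transport List.equivSigmaTuple.symm
    (dSmooth_equivSigmaTuple_symm X) (dSmooth_equivSigmaTuple X) List.equivSigmaTuple.symm
    (dSmooth_equivSigmaTuple_symm Y) (dSmooth_equivSigmaTuple Y) _ fun _ => rfl

end TangentModel

/-- The tangent bundle at a first order type. -/
def Ty.tangentModel : ∀ (τ : Ty) (h : τ.FirstOrder),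
    TangentModel τ.sem τ.D.sem (τ.toTangent h)
  | .real, _ => TangentModel.real
  | .prod _ σ, h => TangentModel.pi fun i => (σ i).tangentModel (h i)
  | .fn _ _, h => h.elim
  | .variant _ σ, h => TangentModel.sigma fun i => (σ i).tangentModel (h i)
  | .list τ, h => (τ.tangentModel h).list

/-- The tangent bundle at a first order context. -/
def Ctx.tangentModel : ∀ (Γ : Ctx) (h : Γ.FirstOrder),
    TangentModel Γ.sem Γ.D.sem (Γ.toTangent h)
  | .nil, _ => TangentModel.unit
  | .snoc Γ τ, h => (Γ.tangentModel h.1).prod (τ.tangentModel h.2)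
  | .block Γ _ σ, h =>
    (Γ.tangentModel h.1).prod (TangentModel.pi fun i => (σ i).tangentModel (h.2 i))

universe u

/-! ### Semantics of renamings and of the derived term formers -/

/-- Renaming of terms is precomposition with the induced map of environments. -/
theorem Term.sem_rename {O : Ops.{u}} {Γ : Ctx} {τ : Ty} (t : Term O Γ τ) {Δ : Ctx}
    (r : Ren Γ Δ) (ρ : Δ.sem) (ρ' : Γ.sem) (h : ∀ τ x, (r τ x).sem ρ = x.sem ρ') :
    (t.rename r).sem ρ = t.sem ρ' := by
  have hsnoc : ∀ {Γ Δ : Ctx} {r : Ren Γ Δ} {ρ : Δ.sem} {ρ' : Γ.sem},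
      (∀ τ x, (r τ x).sem ρ = x.sem ρ') → ∀ (σ : Ty) (a : σ.sem) (τ : Ty) (x : Var (Γ.snoc σ) τ),
        (r.snoc σ τ x).sem ((ρ, a) : (Δ.snoc σ).sem) = x.sem ((ρ', a) : (Γ.snoc σ).sem) := by
    intro Γ Δ r ρ ρ' h σ a τ x
    cases x with
    | last => rfl
    | skip x => exact h _ x
  have hblock : ∀ {Γ Δ : Ctx} {r : Ren Γ Δ} {ρ : Δ.sem} {ρ' : Γ.sem},
      (∀ τ x, (r τ x).sem ρ = x.sem ρ') → ∀ (n : ℕ) (σ : Fin n → Ty) (a : ∀ i, (σ i).sem)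
        (τ : Ty) (x : Var (Γ.block n σ) τ),
        (r.block n σ τ x).sem ((ρ, a) : (Δ.block n σ).sem) =
          x.sem ((ρ', a) : (Γ.block n σ).sem) := by
    intro Γ Δ r ρ ρ' h n σ a τ x
    cases x with
    | inBlock i => rfl
    | skipBlock x => exact h _ x
  induction t generalizing Δ with
  | var x => exact h _ x
  | const c => rfl
  | add t s iht ihs => exact congrArg₂ (fun a b : ℝ => a + b) (iht r ρ ρ' h) (ihs r ρ ρ' h)
  | mul t s iht ihs => exact congrArg₂ (fun a b : ℝ => a * b) (iht r ρ ρ' h) (ihs r ρ ρ' h)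
  | sigmoid t iht => exact congrArg Real.sigmoid (iht r ρ ρ' h)
  | op o t iht => exact congrArg (O.interp o) (funext fun i => iht i r ρ ρ' h)
  | tuple t iht => exact funext fun i => iht i r ρ ρ' h
  | split t s iht ihs =>
    refine (ihs _ _ _ (hblock h _ _ _)).trans ?_
    exact congrArg (fun a => s.sem (ρ', a)) (iht r ρ ρ' h)
  | lam t iht => exact Subtype.ext (funext fun a => iht _ _ _ (hsnoc h _ a))
  | app t s iht ihs =>
    change ((t.rename r).sem ρ).1 ((s.rename r).sem ρ) = (t.sem ρ').1 (s.sem ρ')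
    rw [iht r ρ ρ' h, ihs r ρ ρ' h]
  | inj i t iht => exact congrArg (Sigma.mk i) (iht r ρ ρ' h)
  | @cases Γ n σ τ t s iht ihs =>
    have e : ∀ z : Σ i, (σ i).sem, ((s z.1).rename (r.snoc _)).sem ((ρ, z.2) : (Δ.snoc _).sem) =
        (s z.1).sem ((ρ', z.2) : (Γ.snoc _).sem) := fun z => ihs z.1 _ _ _ (hsnoc h _ z.2)
    refine (e _).trans ?_
    exact congrArg (fun z : Σ i, (σ i).sem => (s z.1).sem (ρ', z.2)) (iht r ρ ρ' h)
  | nil => rfl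
  | cons t s iht ihs => exact congrArg₂ List.cons (iht r ρ ρ' h) (ihs r ρ ρ' h)
  | fold t s u iht ihs ihu =>
    change List.foldr _ ((u.rename r).sem ρ) ((s.rename r).sem ρ) =
      List.foldr _ (u.sem ρ') (s.sem ρ')
    rw [ihs r ρ ρ' h, ihu r ρ ρ' h]
    congr 1
    funext a b
    exact iht _ _ _ (hsnoc (hsnoc h _ a) _ b)

/-- The environment of `pairsCtx Γ k` given by an environment of `Γ` and `k` pairs of reals. -/
def pairsEnv {Γ : Ctx} (ρ : Γ.sem) : ∀ {k : ℕ}, (Fin k → Fin 2 → ℝ) → (pairsCtx Γ k).sem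
  | 0, _ => ρ
  | _ + 1, a => (pairsEnv ρ fun i => a i.castSucc, a (Fin.last _))

theorem pairsVar_last {Γ : Ctx} (k : ℕ) (j : Fin 2) :
    pairsVar (Γ := Γ) (Fin.last k) j = .inBlock (σ := fun _ => .real) j :=
  Fin.lastCases_last (motive := fun _ => Var (pairsCtx Γ (k + 1)) .real)

theorem pairsVar_castSucc {Γ : Ctx} {k : ℕ} (i : Fin k) (j : Fin 2) :
    pairsVar (Γ := Γ) i.castSucc j = .skipBlock (pairsVar i j) :=
  Fin.lastCases_castSucc (motive := fun _ => Var (pairsCtx Γ (k + 1)) .real) i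

theorem sem_pairsVar {Γ : Ctx} (ρ : Γ.sem) : ∀ {k : ℕ} (a : Fin k → Fin 2 → ℝ) (i : Fin k)
    (j : Fin 2), (pairsVar i j).sem (pairsEnv ρ a) = a i j
  | 0, _, i, _ => i.elim0
  | k + 1, a, i, j => by
    refine Fin.lastCases ?_ (fun i' => ?_) i
    · exact congrArg (fun x : Var (pairsCtx Γ (k + 1)) .real => x.sem (pairsEnv ρ a))
        (pairsVar_last k j)
    · exact (congrArg (fun x : Var (pairsCtx Γ (k + 1)) .real => x.sem (pairsEnv ρ a))
        (pairsVar_castSucc i' j)).trans (sem_pairsVar ρ (fun i => a i.castSucc) i' j)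

theorem sem_pairsWk {Γ : Ctx} (ρ : Γ.sem) : ∀ {k : ℕ} (a : Fin k → Fin 2 → ℝ) (τ : Ty)
    (x : Var Γ τ), (pairsWk k τ x).sem (pairsEnv ρ a) = x.sem ρ
  | 0, _, _, _ => rfl
  | _ + 1, a, τ, x => sem_pairsWk ρ (fun i => a i.castSucc) τ x

/-- All matched terms are evaluated in the original `ρ`: each is weakened past the pairs bound
before it, and weakening does not change its value. -/
theorem sem_splitPairs {O : Ops.{u}} {Γ : Ctx} {τ : Ty} (ρ : Γ.sem) : ∀ {k : ℕ}
    (t : Fin k → Term O Γ (.prod 2 (fun _ => .real))) (s : Term O (pairsCtx Γ k) τ),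
    (splitPairs t s).sem ρ = s.sem (pairsEnv ρ fun i => (t i).sem ρ)
  | 0, _, _ => rfl
  | k + 1, t, s => by
    refine (sem_splitPairs ρ (fun i => t i.castSucc) _).trans ?_
    refine congrArg (fun a => s.sem (pairsEnv ρ fun i => (t i.castSucc).sem ρ, a)) ?_
    exact Term.sem_rename _ _ _ _ (sem_pairsWk ρ _)

/-- The value of a term of type `real`. -/
def Term.eval {O : Ops.{u}} {Γ : Ctx} (t : Term O Γ .real) (ρ : Γ.sem) : ℝ := t.sem ρ

/-- The value of a term of type `real * real`. -/
def Term.evalPair {O : Ops.{u}} {Γ : Ctx} (t : Term O Γ (.prod 2 (fun _ => .real)))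
    (ρ : Γ.sem) : Fin 2 → ℝ := t.sem ρ

/-! ### Values of the terms produced by the macro, as reals and dual numbers. -/

section Eval

variable {O : Ops.{u}} {Γ : Ctx} (ρ : Γ.sem)

theorem Term.eval_add (t s : Term O Γ .real) : (t.add s).eval ρ = t.eval ρ + s.eval ρ := rfl

theorem Term.eval_mul (t s : Term O Γ .real) : (t.mul s).eval ρ = t.eval ρ * s.eval ρ := rfl

theorem Term.eval_op {n : ℕ} (o : O.Op n) (t : Fin n → Term O Γ .real) :
    (Term.op o t).eval ρ = O.interp o (fun i => (t i).eval ρ) := rfl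

theorem Term.eval_sum : ∀ {n : ℕ} (t : Fin n → Term O Γ .real),
    (Term.sum t).eval ρ = ∑ i, (t i).eval ρ
  | 0, _ => rfl
  | n + 1, t => by
    rw [Fin.sum_univ_succ, ← Term.eval_sum fun i => t i.succ]
    rfl

theorem Term.eval_pairsVar {k : ℕ} (a : Fin k → Fin 2 → ℝ) (i : Fin k) (j : Fin 2) :
    (Term.var (O := O) (pairsVar i j)).eval (pairsEnv ρ a) = a i j := sem_pairsVar ρ a i j

/-- Applied to the terms for `∂ᵢ op`: inside the macro they are evaluated at the primal components
only. -/
theorem Term.eval_rename_pairsRen {n : ℕ} (t : Term O (realCtx n) .real)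
    (a : Fin n → Fin 2 → ℝ) :
    (t.rename pairsRen).eval (pairsEnv ρ a) = t.eval ((), fun i => a i 0) := by
  refine Term.sem_rename t _ _ _ fun τ x => ?_
  cases x with
  | inBlock i => exact sem_pairsVar ρ a i 0
  | skipBlock x => exact nomatch x

theorem Term.evalPair_dual (t s : Term O Γ .real) :
    (t.dual s).evalPair ρ = ![t.eval ρ, s.eval ρ] := by
  funext i
  fin_cases i
  · rfl
  · rfl

theorem Term.evalPair_splitPairs {k : ℕ} (t : Fin k → Term O Γ (.prod 2 (fun _ => .real)))
    (s : Term O (pairsCtx Γ k) (.prod 2 (fun _ => .real))) :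
    (splitPairs t s).evalPair ρ = s.evalPair (pairsEnv ρ fun i => (t i).evalPair ρ) :=
  sem_splitPairs ρ t s

theorem Term.evalPair_letIn {σ : Ty} (t : Term O Γ σ)
    (s : Term O (Γ.snoc σ) (.prod 2 (fun _ => .real))) :
    (t.letIn s).evalPair ρ = s.evalPair ((ρ, t.sem ρ) : (Γ.snoc σ).sem) := rfl

variable (pd : Partials O)

theorem Term.evalPair_D_add (t s : Term O Γ .real) (ρ : Γ.D.sem) :
    ((t.add s).D pd).evalPair ρ =
      ![(t.D pd).evalPair ρ 0 + (s.D pd).evalPair ρ 0,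
        (t.D pd).evalPair ρ 1 + (s.D pd).evalPair ρ 1] := by
  refine (Term.evalPair_splitPairs _ _ _).trans ((Term.evalPair_dual _ _ _).trans ?_)
  simp only [Term.eval_add, Term.eval_pairsVar]
  rfl

theorem Term.evalPair_D_mul (t s : Term O Γ .real) (ρ : Γ.D.sem) :
    ((t.mul s).D pd).evalPair ρ =
      ![(t.D pd).evalPair ρ 0 * (s.D pd).evalPair ρ 0,
        (t.D pd).evalPair ρ 0 * (s.D pd).evalPair ρ 1
          + (t.D pd).evalPair ρ 1 * (s.D pd).evalPair ρ 0] := by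
  refine (Term.evalPair_splitPairs _ _ _).trans ((Term.evalPair_dual _ _ _).trans ?_)
  simp only [Term.eval_add, Term.eval_mul, Term.eval_pairsVar]
  rfl

theorem Term.evalPair_D_sigmoid (t : Term O Γ .real) (ρ : Γ.D.sem) :
    (t.sigmoid.D pd).evalPair ρ =
      ![Real.sigmoid ((t.D pd).evalPair ρ 0),
        (t.D pd).evalPair ρ 1 * Real.sigmoid ((t.D pd).evalPair ρ 0)
          * (1 - Real.sigmoid ((t.D pd).evalPair ρ 0))] := by
  refine (Term.evalPair_splitPairs _ _ _).trans ((Term.evalPair_letIn _ _ _).trans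
    ((Term.evalPair_dual _ _ _).trans ?_))
  -- The language has no subtraction, so the macro's `1 - z` denotes `1 + (-1) * z`.
  have key (u v : ℝ) : ![v, u * v * (1 + -1 * v)] = ![v, u * v * (1 - v)] := by
    rw [neg_one_mul, ← sub_eq_add_neg]
  let a : Fin 1 → Fin 2 → ℝ := fun i => (![t.D pd] i).evalPair ρ
  have hx := Term.eval_pairsVar (O := O) ρ a 0 1
  have hz := congrArg Real.sigmoid (Term.eval_pairsVar (O := O) ρ a 0 0)
  exact (congrArg₂ (fun u v : ℝ => ![v, u * v * (1 + -1 * v)]) hx hz).trans (key _ _)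

theorem Term.evalPair_D_op {n : ℕ} (o : O.Op n) (t : Fin n → Term O Γ .real) (ρ : Γ.D.sem) :
    ((Term.op o t).D pd).evalPair ρ =
      ![O.interp o fun i => ((t i).D pd).evalPair ρ 0,
        ∑ i, ((t i).D pd).evalPair ρ 1 *
          (pd n o i).eval ((), fun i => ((t i).D pd).evalPair ρ 0)] := by
  refine (Term.evalPair_splitPairs _ _ _).trans ((Term.evalPair_dual _ _ _).trans ?_)
  simp only [Term.eval_op, Term.eval_sum, Term.eval_mul, Term.eval_pairsVar,
    Term.eval_rename_pairsRen]

end Eval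

/-! ### The logical relation -/

/-- The chain rule in terms of partial derivatives. -/
theorem hasDerivAt_comp_partials {n : ℕ} {F : (Fin n → ℝ) → ℝ} (hF : Differentiable ℝ F)
    {f : Fin n → ℝ → ℝ} {f' : Fin n → ℝ} {t : ℝ} (hf : ∀ i, HasDerivAt (f i) (f' i) t) :
    HasDerivAt (fun t => F fun i => f i t)
      (∑ i, f' i * deriv (fun s => F (Function.update (fun i => f i t) i s)) (f i t)) t := by
  set x : Fin n → ℝ := fun i => f i t
  have hx : HasFDerivAt F (fderiv ℝ F x) x := (hF x).hasFDerivAt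
  have h1 := hx.comp_hasDerivAt t (hasDerivAt_pi.2 hf)
  -- Expanding the velocity in the standard basis turns the total derivative into a sum of partial
  -- derivatives.
  have e : f' = ∑ i, f' i • (Pi.single i (1 : ℝ) : Fin n → ℝ) := by
    simpa using pi_eq_sum_univ' f'
  have e' := congrArg (fderiv ℝ F x) e
  rw [map_sum] at e'
  refine h1.congr_deriv (e'.trans (Finset.sum_congr rfl fun i _ => ?_))
  rw [map_smul, smul_eq_mul]
  congr 1
  have h2 : HasFDerivAt F (fderiv ℝ F x) (Function.update x i (x i)) := by simpa using hx
  exact (h2.comp_hasDerivAt (x i) (hasDerivAt_update x i (x i))).deriv.symm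

/-- The curve `g` consists of the values and the derivatives of `f`. -/
def IsDual (f : ℝ → ℝ) (g : ℝ → Fin 2 → ℝ) : Prop :=
  ContDiff ℝ ∞ f ∧ ∀ t, g t = ![f t, deriv f t]

theorem IsDual.of_hasDerivAt {f f' : ℝ → ℝ} {g : ℝ → Fin 2 → ℝ} (h : ContDiff ℝ ∞ f)
    (h' : ∀ t, HasDerivAt f (f' t) t) (hg : ∀ t, g t = ![f t, f' t]) : IsDual f g :=
  ⟨h, fun t => by rw [hg, (h' t).deriv]⟩

theorem IsDual.hasDerivAt {f : ℝ → ℝ} {g : ℝ → Fin 2 → ℝ} (h : IsDual f g) (t : ℝ) :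
    HasDerivAt f (deriv f t) t := (h.1.differentiable (by simp) t).hasDerivAt

namespace IsDual

variable {f f' : ℝ → ℝ} {g g' u : ℝ → Fin 2 → ℝ}

theorem add (h : IsDual f g) (h' : IsDual f' g')
    (hu : ∀ t, u t = ![g t 0 + g' t 0, g t 1 + g' t 1]) : IsDual (fun t => f t + f' t) u :=
  of_hasDerivAt (h.1.add h'.1) (fun t => (h.hasDerivAt t).add (h'.hasDerivAt t)) fun t => by
    rw [hu, h.2, h'.2]
    rfl

theorem mul (h : IsDual f g) (h' : IsDual f' g')
    (hu : ∀ t, u t = ![g t 0 * g' t 0, g t 0 * g' t 1 + g t 1 * g' t 0]) :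
    IsDual (fun t => f t * f' t) u :=
  of_hasDerivAt (h.1.mul h'.1) (fun t => (h.hasDerivAt t).mul (h'.hasDerivAt t)) fun t => by
    rw [hu, h.2, h'.2, add_comm]
    rfl

theorem sigmoid (h : IsDual f g)
    (hu : ∀ t, u t = ![Real.sigmoid (g t 0),
      g t 1 * Real.sigmoid (g t 0) * (1 - Real.sigmoid (g t 0))]) :
    IsDual (fun t => Real.sigmoid (f t)) u :=
  of_hasDerivAt ((contDiff_sigmoid.of_le le_top).comp h.1)
    (fun t => (Real.hasDerivAt_sigmoid _).comp t (h.hasDerivAt t)) fun t => by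
      rw [hu, h.2, mul_assoc, mul_comm]
      rfl

theorem comp {n : ℕ} {F : (Fin n → ℝ) → ℝ} (hF : ContDiff ℝ ∞ F) {f : Fin n → ℝ → ℝ}
    {g : Fin n → ℝ → Fin 2 → ℝ} (h : ∀ i, IsDual (f i) (g i))
    (hu : ∀ t, u t = ![F fun i => g i t 0, ∑ i, g i t 1 *
      deriv (fun s => F (Function.update (fun i => g i t 0) i s)) (g i t 0)]) :
    IsDual (fun t => F fun i => f i t) u :=
  of_hasDerivAt (hF.comp (contDiff_pi.2 fun i => (h i).1))
    (fun t => hasDerivAt_comp_partials (hF.differentiable (by simp))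
      fun i => (h i).hasDerivAt t) fun t => by
      simp only [hu, (h _).2]
      rfl

/-- Supplies, for each dual number, a related pair of curves passing through it at time 0. -/
theorem line (a : Fin 2 → ℝ) :
    IsDual (fun t => a 0 + a 1 * t) (fun t => ![a 0 + a 1 * t, a 1]) :=
  of_hasDerivAt (by fun_prop)
    (fun t => by simpa using ((hasDerivAt_id t).const_mul (a 1)).const_add (a 0)) fun _ => rfl

/-- A smooth curve in `ℝ` is tangent to a straight line. -/
theorem mk_realLine (h : IsDual f g) :
    Tangent.mk (realLine (g 0 0) (g 0 1)) = Tangent.mk ⟨f, h.1.dSmooth⟩ := by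
  rw [h.2]
  refine Quotient.sound (s := tangentSetoid ℝ) ⟨?_, fun u => ?_⟩
  · change f 0 + deriv f 0 * 0 = f 0
    ring
  · have hu : ∀ x, HasDerivAt u.1 (deriv u.1 x) x :=
      fun x => (u.2.contDiff.differentiable (by simp) x).hasDerivAt
    have hl : HasDerivAt (fun t => f 0 + deriv f 0 * t) (deriv f 0) 0 := by
      simpa using ((hasDerivAt_id (0 : ℝ)).const_mul (deriv f 0)).const_add (f 0)
    refine (HasDerivAt.comp (0 : ℝ) (hu _) hl).deriv.trans ?_
    refine Eq.trans ?_ (HasDerivAt.comp (0 : ℝ) (hu _) (h.hasDerivAt 0)).deriv.symm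
    rw [mul_zero, add_zero]

end IsDual

/-- Curves in `⟦τ⟧` and `⟦D τ⟧` are related if, at the type of reals, the second consists of the
values and the derivatives of the first. -/
def Ty.Rel : ∀ τ : Ty, (ℝ → τ.sem) → (ℝ → τ.D.sem) → Prop
  | .real, f, g => IsDual f g
  | .prod _ σ, f, g => ∀ i, (σ i).Rel (fun t => f t i) (fun t => g t i)
  | .fn σ τ, f, g => ∀ a b, σ.Rel a b →
      τ.Rel (fun t => (f t).1 (a t)) (fun t => (g t).1 (b t))
  | .variant _ σ, f, g => ∃ i a b, (σ i).Rel a b ∧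
      (f = fun t => ⟨i, a t⟩) ∧ (g = fun t => ⟨i, b t⟩)
  | .list τ, f, g => ∃ (k : ℕ) (a : Fin k → ℝ → τ.sem) (b : Fin k → ℝ → τ.D.sem),
      (∀ i, τ.Rel (a i) (b i)) ∧
      (f = fun t => List.ofFn fun i => a i t) ∧ (g = fun t => List.ofFn fun i => b i t)

/-- Related curves of environments. -/
def Ctx.Rel (Γ : Ctx) (f : ℝ → Γ.sem) (g : ℝ → Γ.D.sem) : Prop :=
  ∀ (τ : Ty) (x : Var Γ τ), τ.Rel (fun t => x.sem (f t)) (fun t => x.D.sem (g t))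

theorem Ctx.Rel.snoc {Γ : Ctx} {f : ℝ → Γ.sem} {g : ℝ → Γ.D.sem} (h : Γ.Rel f g) {σ : Ty}
    {a : ℝ → σ.sem} {b : ℝ → σ.D.sem} (h' : σ.Rel a b) :
    (Γ.snoc σ).Rel (fun t => (f t, a t)) (fun t => (g t, b t)) := by
  intro τ x
  cases x with
  | last => exact h'
  | skip x => exact h _ x

theorem Ctx.Rel.block {Γ : Ctx} {f : ℝ → Γ.sem} {g : ℝ → Γ.D.sem} (h : Γ.Rel f g) {n : ℕ}
    {σ : Fin n → Ty} {a : ∀ i, ℝ → (σ i).sem} {b : ∀ i, ℝ → (σ i).D.sem}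
    (h' : ∀ i, (σ i).Rel (a i) (b i)) :
    (Γ.block n σ).Rel (fun t => (f t, fun i => a i t)) (fun t => (g t, fun i => b i t)) := by
  intro τ x
  cases x with
  | inBlock i => exact h' i
  | skipBlock x => exact h _ x

/-- The fundamental lemma of the logical relation. -/
theorem Term.rel_sem {O : Ops.{u}} {pd : Partials O} (hpd : pd.Correct) {Γ : Ctx} {τ : Ty}
    (t : Term O Γ τ) {f : ℝ → Γ.sem} {g : ℝ → Γ.D.sem} (h : Γ.Rel f g) :
    τ.Rel (fun x => t.sem (f x)) (fun x => (t.D pd).sem (g x)) := by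
  induction t with
  | var x => exact h _ x
  | const c =>
    exact IsDual.of_hasDerivAt contDiff_const (fun _ => hasDerivAt_const _ c)
      fun x => Term.evalPair_dual _ _ _
  | add t s iht ihs =>
    exact IsDual.add (iht h) (ihs h) fun x => Term.evalPair_D_add pd t s (g x)
  | mul t s iht ihs =>
    exact IsDual.mul (iht h) (ihs h) fun x => Term.evalPair_D_mul pd t s (g x)
  | sigmoid t iht => exact IsDual.sigmoid (iht h) fun x => Term.evalPair_D_sigmoid pd t (g x)
  | op o t iht =>
    refine IsDual.comp (O.smooth o) (fun i => iht i h)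
      fun x => (Term.evalPair_D_op pd o t (g x)).trans ?_
    -- Here correctness of the chosen terms `∂ᵢ op` turns the tangent component into the sum in the
    -- chain rule.
    refine congrArg₂ (fun a b : ℝ => ![a, b]) rfl ?_
    exact Finset.sum_congr rfl fun i _ => congrArg _ (hpd _ o i _)
  | tuple t iht => exact fun i => iht i h
  | split t s iht ihs => exact ihs (h.block (iht h))
  | lam t iht => exact fun a b hab => iht (h.snoc hab)
  | app t s iht ihs => exact iht h _ _ (ihs h)
  | inj i t iht => exact ⟨i, _, _, iht h, rfl, rfl⟩
  -- Related curves in a variant keep one common label `i` at all times, so both case distinctions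
  -- always take the branch `s i`.
  | @cases Γ n σ τ t s iht ihs =>
    obtain ⟨i, a, b, hab, ea, eb⟩ := iht h
    have h1 : (fun x => (Term.cases t s).sem (f x)) = fun x => (s i).sem (f x, a x) :=
      funext fun x => congrArg (fun z : Σ i, (σ i).sem => (s z.1).sem (f x, z.2)) (congrFun ea x)
    have h2 : (fun x => ((Term.cases t s).D pd).sem (g x)) =
        fun x => ((s i).D pd).sem (g x, b x) :=
      funext fun x => congrArg (fun z : Σ i, (σ i).D.sem => ((s z.1).D pd).sem (g x, z.2))
        (congrFun eb x)
    rw [h1, h2]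
    exact ihs i (h.snoc hab)
  | nil => exact ⟨0, Fin.elim0, Fin.elim0, fun i => i.elim0, rfl, rfl⟩
  | cons t s iht ihs =>
    obtain ⟨k, a, b, hab, ea, eb⟩ := ihs h
    refine ⟨k + 1, Fin.cons (fun x => t.sem (f x)) a,
      Fin.cons (fun x => (t.D pd).sem (g x)) b, fun i => ?_, ?_, ?_⟩
    · refine Fin.cases ?_ (fun j => ?_) i
      · exact iht h
      · exact hab j
    · funext x
      simp only [List.ofFn_succ, Fin.cons_zero, Fin.cons_succ]
      exact congrArg (List.cons _) (congrFun ea x)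
    · funext x
      simp only [List.ofFn_succ, Fin.cons_zero, Fin.cons_succ]
      exact congrArg (List.cons _) (congrFun eb x)
  | @fold Γ σ τ t s r iht ihs ihr =>
    obtain ⟨k, a, b, hab, ea, eb⟩ := ihs h
    -- Related lists have a common length independent of time, so the fold is handled by induction
    -- on that length.
    have key : ∀ (k : ℕ) (a : Fin k → ℝ → τ.sem) (b : Fin k → ℝ → τ.D.sem),
        (∀ i, τ.Rel (a i) (b i)) →
        σ.Rel (fun x => (List.ofFn fun i => a i x).foldr (fun y z => t.sem ((f x, y), z))
          (r.sem (f x))) (fun x => (List.ofFn fun i => b i x).foldr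
            (fun y z => (t.D pd).sem ((g x, y), z)) ((r.D pd).sem (g x))) := by
      intro k
      induction k with
      | zero => intro a b _; exact ihr h
      | succ k ih =>
        intro a b hab
        simp only [List.ofFn_succ, List.foldr_cons]
        exact iht ((h.snoc (hab 0)).snoc (ih _ _ fun i => hab i.succ))
    have h1 : (fun x => (Term.fold t s r).sem (f x)) = fun x =>
        (List.ofFn fun i => a i x).foldr (fun y z => t.sem ((f x, y), z)) (r.sem (f x)) :=
      funext fun x => congrArg
        (List.foldr (fun y z => t.sem ((f x, y), z)) (r.sem (f x))) (congrFun ea x)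
    have h2 : (fun x => ((Term.fold t s r).D pd).sem (g x)) = fun x =>
        (List.ofFn fun i => b i x).foldr (fun y z => (t.D pd).sem ((g x, y), z))
          ((r.D pd).sem (g x)) :=
      funext fun x => congrArg
        (List.foldr (fun y z => (t.D pd).sem ((g x, y), z)) ((r.D pd).sem (g x))) (congrFun eb x)
    rw [h1, h2]
    exact key k a b hab

/-! ### From related curves to tangent vectors. -/

/-- The canonical map at lists, for lists given as tuples. -/
theorem Ty.toTangent_ofFn {τ : Ty} (hτ : τ.FirstOrder) {k : ℕ} (a : Fin k → τ.D.sem) :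
    Ty.toTangent (.list τ) hτ (List.ofFn a) =
      Tangent.map (listMap k) (Tangent.tuple fun i => τ.toTangent hτ (a i)) := by
  -- The index set of the tuple depends on the length of the list; writing both sides as values of
  -- one function on pairs of length and entries avoids casts.
  let F : (Σ k, Fin k → τ.D.sem) → Tangent (List τ.sem) := fun z =>
    Tangent.map (listMap z.1) (Tangent.tuple fun i => τ.toTangent hτ (z.2 i))
  exact congrArg F (List.equivSigmaTuple.apply_symm_apply ⟨k, a⟩)

/-- Related curves at a first order type represent the same tangent vectors. -/
theorem Ty.Rel.toTangent : ∀ {τ : Ty} (hτ : τ.FirstOrder) {f : ℝ → τ.sem} {g : ℝ → τ.D.sem},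
    τ.Rel f g → ∃ hf : DSmooth f, τ.toTangent hτ (g 0) = Tangent.mk ⟨f, hf⟩
  | .real, _, f, g, h => ⟨h.1.dSmooth, IsDual.mk_realLine h⟩
  | .prod n σ, hτ, f, g, h => by
    choose hf e using fun i => (h i).toTangent (hτ i)
    refine ⟨fun n p hp i => hf i n p hp, ?_⟩
    refine (congrArg Tangent.tuple (funext e)).trans ?_
    exact Tangent.tuple_mk _
  | .fn _ _, hτ, _, _, _ => hτ.elim
  | .variant n σ, hτ, _, _, ⟨i, a, b, hab, rfl, rfl⟩ => by
    obtain ⟨hf, e⟩ := hab.toTangent (hτ i)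
    exact ⟨(injMap (X := fun i => (σ i).sem) i).2.comp hf,
      congrArg (Tangent.map (injMap (X := fun i => (σ i).sem) i)) e⟩
  | .list τ, hτ, _, _, ⟨k, a, b, hab, rfl, rfl⟩ => by
    choose hf e using fun i => (hab i).toTangent (τ := τ) hτ
    refine ⟨(listMap k).2.comp (f := fun t i => a i t) fun n p hp i => hf i n p hp, ?_⟩
    have e' := (congrArg Tangent.tuple (funext e)).trans (Tangent.tuple_mk _)
    exact (Ty.toTangent_ofFn (τ := τ) hτ _).trans (congrArg (Tangent.map (listMap k)) e')

/-- Lines through the given dual numbers at the real leaves, with labels and list lengths held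
fixed, assemble to related curves through `a`. -/
theorem Ty.exists_rel : ∀ {τ : Ty}, τ.FirstOrder → ∀ a : τ.D.sem,
    ∃ (f : ℝ → τ.sem) (g : ℝ → τ.D.sem), τ.Rel f g ∧ g 0 = a
  | .real, _, a => by
    refine ⟨_, _, IsDual.line a, funext fun i => ?_⟩
    have h0 (x y : ℝ) : x + y * 0 = x := by ring
    fin_cases i
    · exact h0 _ _
    · rfl
  | .prod n σ, hτ, a => by
    choose f g h e using fun i => Ty.exists_rel (hτ i) (a i)
    exact ⟨fun t i => f i t, fun t i => g i t, h, funext e⟩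
  | .fn _ _, hτ, _ => hτ.elim
  | .variant n σ, hτ, ⟨i, a⟩ => by
    obtain ⟨f, g, h, rfl⟩ := Ty.exists_rel (hτ i) a
    exact ⟨_, _, ⟨i, f, g, h, rfl, rfl⟩, rfl⟩
  | .list τ, hτ, a => by
    choose f g h e using fun i => Ty.exists_rel (τ := τ) hτ (List.get a i)
    refine ⟨_, _, ⟨List.length a, f, g, h, rfl, rfl⟩, ?_⟩
    simp only [e]
    exact List.ofFn_get a

theorem Ctx.Rel.toTangent : ∀ {Γ : Ctx} (hΓ : Γ.FirstOrder) {f : ℝ → Γ.sem} {g : ℝ → Γ.D.sem},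
    Γ.Rel f g → ∃ hf : DSmooth f, Γ.toTangent hΓ (g 0) = Tangent.mk ⟨f, hf⟩
  | .nil, _, _, _, _ => ⟨fun _ _ _ => trivial, rfl⟩
  | .snoc Γ τ, hΓ, f, g, h => by
    obtain ⟨h1, e1⟩ := Ctx.Rel.toTangent (Γ := Γ) (f := fun t => (f t).1) (g := fun t => (g t).1)
      hΓ.1 fun _ x => h _ x.skip
    obtain ⟨h2, e2⟩ := Ty.Rel.toTangent (τ := τ) hΓ.2 (h _ .last)
    exact ⟨fun n p hp => ⟨h1 n p hp, h2 n p hp⟩, congrArg₂ Tangent.pair e1 e2⟩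
  | .block Γ n σ, hΓ, f, g, h => by
    obtain ⟨h1, e1⟩ := Ctx.Rel.toTangent (Γ := Γ) (f := fun t => (f t).1) (g := fun t => (g t).1)
      hΓ.1 fun _ x => h _ x.skipBlock
    choose h2 e2 using fun i => Ty.Rel.toTangent (hΓ.2 i) (h _ (.inBlock i))
    refine ⟨fun n p hp => ⟨h1 n p hp, fun i => h2 i n p hp⟩, ?_⟩
    have e3 := (congrArg Tangent.tuple (funext e2)).trans (Tangent.tuple_mk _)
    exact congrArg₂ Tangent.pair e1 e3

theorem Ctx.exists_rel : ∀ {Γ : Ctx}, Γ.FirstOrder → ∀ ρ : Γ.D.sem,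
    ∃ (f : ℝ → Γ.sem) (g : ℝ → Γ.D.sem), Γ.Rel f g ∧ g 0 = ρ
  | .nil, _, _ => ⟨fun _ => (), fun _ => (), (fun _ x => nomatch x), rfl⟩
  | .snoc Γ τ, hΓ, ρ => by
    obtain ⟨f, g, h, e⟩ := Ctx.exists_rel hΓ.1 ρ.1
    obtain ⟨f', g', h', e'⟩ := Ty.exists_rel hΓ.2 ρ.2
    exact ⟨_, _, h.snoc h', Prod.ext e e'⟩
  | .block Γ n σ, hΓ, ρ => by
    obtain ⟨f, g, h, e⟩ := Ctx.exists_rel hΓ.1 ρ.1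
    choose f' g' h' e' using fun i => Ty.exists_rel (hΓ.2 i) (ρ.2 i)
    exact ⟨_, _, h.block h', Prod.ext e (funext e')⟩

end AD

end

open AD
theorem theorem2 (O : Ops) (pd : Partials O) (hpd : pd.Correct)
    (Γ : Ctx) (hΓ : Γ.FirstOrder) (τ : Ty) (hτ : τ.FirstOrder) (t : Term O Γ τ) :
    IsSmoothManifold Γ.sem ∧ IsSmoothManifold τ.sem ∧
      IsDiffeo (Γ.toTangent hΓ) ∧ IsDiffeo (τ.toTangent hτ) ∧
      ∀ ρ : Γ.D.sem,
        τ.toTangent hτ ((t.D pd).sem ρ) = Tangent.map t.sem (Γ.toTangent hΓ ρ) := by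
  refine ⟨(Γ.tangentModel hΓ).isSmoothManifold, (τ.tangentModel hτ).isSmoothManifold,
    (Γ.tangentModel hΓ).isDiffeo, (τ.tangentModel hτ).isDiffeo, fun ρ => ?_⟩
  -- With `ρ = g 0`, both sides of the square become the class of the curve `⟦t⟧ ∘ f`.
  obtain ⟨f, g, h, rfl⟩ := Ctx.exists_rel hΓ ρ
  obtain ⟨hf, e⟩ := h.toTangent hΓ
  obtain ⟨hf', e'⟩ := (t.rel_sem hpd h).toTangent hτ
  exact e'.trans (congrArg (Tangent.map t.sem) e).symm
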